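/- **Theorem 2.** Let $d\ge 3$. A *colored link diagram of degree $d$* is a link diagram whose arcs are labelled by transpositions of $\{1,\dots,d\}$ such that at every crossing the label of the under-strand is conjugated by the label of the over-strand. Move **C** replaces, inside a ball, three half twists of two adjacent strands colored $(a\ b),(b\ c)$ ($a,b,c$ distinct) by the trivial tangle, and move **N** replaces two half twists of two adjacent strands colored $(a\ b),(c\ e)$ ($a,b,c,e$ distinct) by the trivial tangle (or conversely). Consider links in plat form, i.e. plat closures of braids on $n$ strands ($n$ even) numbered $0,\dots,n-1$, with Artin generators $x_i$ (left strand over right). A level of such a diagram is *standardly colored* if $n\ge 2d-2$, the strands $2k,2k+1$ are colored $(d{-}1{-}k\ \ d{-}k)$ for $0\le k\le d-2$, and all further strands are colored $(1\ 2)$. The following moves insert a braid at a horizontal level of a colored plat diagram of degree $d$; the rest of the link is arbitrary. * $\mathrm{II}_i$ $(0\le i\le d-3)$: insert $x_{2i}$ at a standardly colored level. * $\mathrm{III}_{i,j}$ ($i<j$ even, $j\le 2d-4$): at a standardly colored level, insert the braid in which the pair of parallel strands $j,j+1$ moves to the left up to the pair $i,i+1$, passing between the two strands of each intermediate pair $k,k+1$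 ($k$ even; under strand $k+1$ and over strand $k$), makes one positive full twist with the pair $i,i+1$ (the strands within each pair staying parallel), and returns along the same path. * $\mathrm{IV}$: at a level with $n\ge 2d$ strands colored in pairs $(d{-}1\ d),(d{-}2\ d{-}1),\dots,(3\ 4)$, then $(2\ 3),(1\ 3),(2\ 3)$, then $(1\ 2),\dots,(1\ 2)$, insert the braid in which the pair colored $(1\ 3)$ makes one positive full twist with each of the two neighboring pairs colored $(2\ 3)$ (strands within pairs staying parallel), and its own two strands make one positive full twist ($x_{2d-4}^2$). Let $L$ be a colored plat diagram of degree $d$ and let $L'$ be obtained from $L$ by one of the moves $\mathrm{II}_i$, $\mathrm{III}_{i,j}$, $\mathrm{IV}$. Add to both $L$ and $L'$ the $d-2$ unlinked unknots ("trivial sheets") colored $(d{-}j\ \ d{+}1{+}j)$, $0\le j\le d-3$, so that they become colored link diagrams of degree $2d-2$. Then the two resulting diagrams are related by a finite sequence of colored Reidemeister moves (with planar isotopy) and moves C and N. -/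

import Mathlib

open Equiv

/-- Colors of strands. In degree `d` only the transpositions of two labels in `{1, …, d}` occur
(see `IsTransposition`). -/
abbrev Color := Equiv.Perm ℕ

/-- `c` is a transposition in the symmetric group on the labels `1, …, d`. -/
def IsTransposition (d : ℕ) (c : Color) : Prop :=
  ∃ a b : ℕ, 1 ≤ a ∧ a < b ∧ b ≤ d ∧ c = swap a b

/-- The elementary horizontal slices of a link diagram in the plane that is generic with respect
to the height function. Strands at a given height are numbered `0, 1, 2, …` from left to right and
diagrams are read from top to bottom.
* `birth i c`: a local maximum, two new adjacent strands in positions `i`, `i+1`, colored `c`;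
* `death i`: a local minimum, joining the strands in positions `i`, `i+1`;
* `cross i true`: a positive crossing of the strands in positions `i`, `i+1` (left over right);
* `cross i false`: a negative crossing (right over left). -/
inductive Piece where
  | birth (i : ℕ) (c : Color)
  | death (i : ℕ)
  | cross (i : ℕ) (positive : Bool)

/-- A (colored) diagram: the list of its slices, from top to bottom. -/
abbrev Diagram := List Piece

/-- `X.Acts s t`: the slice `X` can follow a level whose strands have, from left to right, the
colors `s`, and then the colors just below it are `t`. At a crossing the color of the under-strand
is conjugated by the color of the over-strand. -/
inductive Piece.Acts : Piece → List Color → List Color → Prop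
  | birth (p q : List Color) (c : Color) :
      Piece.Acts (.birth p.length c) (p ++ q) (p ++ c :: c :: q)
  | death (p q : List Color) (c : Color) :
      Piece.Acts (.death p.length) (p ++ c :: c :: q) (p ++ q)
  | pos (p q : List Color) (a b : Color) :
      Piece.Acts (.cross p.length true) (p ++ a :: b :: q) (p ++ (a * b * a⁻¹) :: a :: q)
  | neg (p q : List Color) (a b : Color) :
      Piece.Acts (.cross p.length false) (p ++ a :: b :: q) (p ++ b :: (b * a * b⁻¹) :: q)

/-- `Runs w s t`: the diagram `w` is a consistently colored tangle diagram whose strands are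
colored `s` at its top and `t` at its bottom. -/
inductive Runs : Diagram → List Color → List Color → Prop
  | nil (s : List Color) : Runs [] s s
  | cons {X : Piece} {w : Diagram} {s t r : List Color} :
      X.Acts s t → Runs w t r → Runs (X :: w) s r

/-- A closed diagram with a consistent coloring by transpositions in the symmetric group on
`{1, …, d}`, that is, the diagram of a colored link of degree `d`. -/
def IsColoredLink (d : ℕ) (w : Diagram) : Prop :=
  Runs w [] [] ∧ ∀ i c, Piece.birth i c ∈ w → IsTransposition d c

/-! ### Isotopy -/

/-- The leftmost position in which a slice acts. -/
def Piece.position : Piece → ℕ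
  | .birth i _ => i
  | .death i => i
  | .cross i _ => i

/-- The same slice in another position. -/
def Piece.moveTo : Piece → ℕ → Piece
  | .birth _ c, k => .birth k c
  | .death _, k => .death k
  | .cross _ e, k => .cross k e

/-- The number of strands that enter a slice at its top. -/
def Piece.strandsIn : Piece → ℕ
  | .birth _ _ => 0
  | .death _ => 2
  | .cross _ _ => 2

/-- The number of strands that leave a slice at its bottom. -/
def Piece.strandsOut : Piece → ℕ
  | .birth _ _ => 2
  | .death _ => 0
  | .cross _ _ => 2

/-- The elementary planar isotopies and the Reidemeister moves for diagrams cut into slices. -/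
inductive Reidemeister : Diagram → Diagram → Prop
  /-- Two slices, `Y` to the right of `X`, exchange their heights. -/
  | exchange (X Y : Piece) (k : ℕ) :
      Reidemeister [X, Y.moveTo (X.position + X.strandsOut + k)]
        [Y.moveTo (X.position + X.strandsIn + k), X]
  /-- A maximum and a minimum cancel. -/
  | zigzagLeft (i : ℕ) (c : Color) : Reidemeister [.birth i c, .death (i + 1)] []
  | zigzagRight (i : ℕ) (c : Color) : Reidemeister [.birth (i + 1) c, .death i] []
  /-- A strand slides across a maximum or a minimum. The color of the arc with the maximum changes
  if it passes under the strand. -/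
  | slideBirth (i : ℕ) (c c' : Color) (e : Bool) :
      Reidemeister [.birth i c, .cross (i + 1) e] [.birth (i + 1) c', .cross i (!e)]
  | slideDeath (i : ℕ) (e : Bool) :
      Reidemeister [.cross (i + 1) e, .death i] [.cross i (!e), .death (i + 1)]
  /-- The first Reidemeister move, at a maximum or a minimum. -/
  | twistBirth (i : ℕ) (c : Color) (e : Bool) :
      Reidemeister [.birth i c, .cross i e] [.birth i c]
  | twistDeath (i : ℕ) (e : Bool) : Reidemeister [.cross i e, .death i] [.death i]
  /-- The second Reidemeister move. -/
  | cancel (i : ℕ) (e : Bool) : Reidemeister [.cross i e, .cross i (!e)] []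
  /-- The third Reidemeister move. -/
  | braid (i : ℕ) :
      Reidemeister [.cross i true, .cross (i + 1) true, .cross i true]
        [.cross (i + 1) true, .cross i true, .cross (i + 1) true]

/-! ### The local moves C and N -/

/-- Move C at a level colored by the first argument: three half twists of two adjacent strands
colored `(a b)` and `(b c)`, with `a, b, c` distinct, are replaced by the trivial tangle. -/
inductive MoveC : List Color → Diagram → Diagram → Prop
  | mk (p q : List Color) (a b c : ℕ) (hab : a ≠ b) (hac : a ≠ c) (hbc : b ≠ c) :
      MoveC (p ++ swap a b :: swap b c :: q) (List.replicate 3 (.cross p.length true)) []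

/-- Move N at a level colored by the first argument: two half twists of two adjacent strands
colored `(a b)` and `(c e)`, with `a, b, c, e` distinct, are replaced by the trivial tangle. -/
inductive MoveN : List Color → Diagram → Diagram → Prop
  | mk (p q : List Color) (a b c e : ℕ) (hab : a ≠ b) (hac : a ≠ c) (hae : a ≠ e)
      (hbc : b ≠ c) (hbe : b ≠ e) (hce : c ≠ e) :
      MoveN (p ++ swap a b :: swap c e :: q) (List.replicate 2 (.cross p.length true)) []

/-- One elementary step between diagrams of colored links of degree `d`: a portion `l` of the
diagram is replaced by `r`, with the same colors at the top and at the bottom, where the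
replacement is an elementary isotopy or a move C or N. -/
def Step (d : ℕ) (w w' : Diagram) : Prop :=
  IsColoredLink d w ∧ IsColoredLink d w' ∧
    ∃ (u l r v : Diagram) (s t : List Color),
      w = u ++ l ++ v ∧ w' = u ++ r ++ v ∧ Runs u [] s ∧ Runs l s t ∧ Runs r s t ∧
        (Reidemeister l r ∨ MoveC s l r ∨ MoveN s l r)

/-- Two diagrams of colored links of degree `d` are related by a finite sequence of colored
Reidemeister moves (and planar isotopies), moves C, moves N, and inverses of these. -/
def CNEquivalent (d : ℕ) : Diagram → Diagram → Prop :=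
  Relation.EqvGen (Step d)

/-! ### Links in plat form -/

/-- A braid word in the Artin generators: `(i, true)` is the positive crossing of the strands in
positions `i`, `i+1` and `(i, false)` is its inverse. Words are read from top to bottom. -/
abbrev BraidWord := List (ℕ × Bool)

/-- The diagram of a braid word. -/
def BraidWord.toDiagram (b : BraidWord) : Diagram :=
  b.map fun x => .cross x.1 x.2

/-- The inverse of a braid word. -/
def BraidWord.inv (b : BraidWord) : BraidWord :=
  (b.map fun x => (x.1, !x.2)).reverse

/-- Plat arcs at the top: the arc number `k` joins the strands `2k` and `2k+1` and has the `k`-th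
color of the list. -/
def platTop (top : List Color) : Diagram :=
  top.mapIdx fun k c => .birth (2 * k) c

/-- The plat closure of a braid word on `2 * top.length` strands, colored by `top` on the plat arcs
at the top. At the bottom the strands `2k` and `2k+1` are joined for each `k`. -/
def plat (top : List Color) (b : BraidWord) : Diagram :=
  platTop top ++ b.toDiagram ++ List.replicate top.length (.death 0)

/-- The list of colors `f 0, f 0, f 1, f 1, …, f (m-1), f (m-1)` of `2m` strands. -/
def pairColors (f : ℕ → Color) (m : ℕ) : List Color :=
  (List.range m).flatMap fun k => [f k, f k]

/-- The standard coloring of degree `d`: the strands `2k` and `2k+1` are colored `(d-1-k  d-k)` if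
`k ≤ d - 2`, and all further strands `(1 2)`. -/
def standardColor (d k : ℕ) : Color :=
  if k + 2 ≤ d then swap (d - 1 - k) (d - k) else swap 1 2

/-- The coloring for move IV: the pairs of strands are colored `(d-1 d), (d-2 d-1), …, (3 4)`, then
`(2 3), (1 3), (2 3)`, and then `(1 2)`. -/
def colorIV (d k : ℕ) : Color :=
  if k + 4 ≤ d then swap (d - 1 - k) (d - k)
  else if k + 3 = d then swap 2 3
  else if k + 2 = d then swap 1 3
  else if k + 1 = d then swap 2 3
  else swap 1 2

/-- `L'` is obtained from the diagram `L` of a colored link of degree `d`, in plat form with `2m`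
strands, by inserting the braid `β` at a level whose strands are colored
`f 0, f 0, …, f (m-1), f (m-1)`. The parts `D` and `E` of the link above and below that level are
arbitrary. -/
def InsertsBraid (d m : ℕ) (f : ℕ → Color) (β : BraidWord) (L L' : Diagram) : Prop :=
  ∃ (top : List Color) (D E : BraidWord),
    top.length = m ∧ L = plat top (D ++ E) ∧ L' = plat top (D ++ β ++ E) ∧
      IsColoredLink d L ∧ Runs (platTop top ++ D.toDiagram) [] (pairColors f m)

/-! ### The moves II, III and IV -/

/-- Move II with index `i`: a half twist of the strands `2i` and `2i+1`. -/
def MoveII (d i : ℕ) (L L' : Diagram) : Prop :=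
  i + 3 ≤ d ∧ ∃ m, d ≤ m + 1 ∧ InsertsBraid d m (standardColor d) [(2 * i, true)] L L'

/-- The full twist of the pair of parallel strands `i, i+1` with the pair of parallel strands
`i+2, i+3`; the two strands of a pair are not twisted with each other. -/
def pairFullTwist (i : ℕ) : BraidWord :=
  [(i + 1, true), (i, true), (i + 2, true), (i + 1, true),
    (i + 1, true), (i, true), (i + 2, true), (i + 1, true)]

/-- A pair of parallel strands, starting in the positions `i + 2 + 2r` and `i + 3 + 2r`, moves to
the left to the positions `i + 2` and `i + 3`. It passes between the two strands of each of the
`r` pairs that it meets: under the right strand of the pair and over the left one. -/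
def pairThread (i : ℕ) : ℕ → BraidWord
  | 0 => []
  | r + 1 =>
      [(i + 2 * r + 3, true), (i + 2 * r + 4, true),
        (i + 2 * r + 2, false), (i + 2 * r + 3, false)] ++ pairThread i r

/-- The braid of move III: the pair of strands `j, j+1`, where `j = i + 2 + 2r`, moves to the left
between the two strands of each pair on its way, makes a full twist with the pair of
strands `i, i+1`, and returns along the same path. -/
def braidIII (i r : ℕ) : BraidWord :=
  pairThread i r ++ pairFullTwist i ++ (pairThread i r).inv

/-- Move III with indices `i < j`, both even, `j ≤ 2d - 4`. -/
def MoveIII (d i j : ℕ) (L L' : Diagram) : Prop :=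
  Even i ∧ j + 4 ≤ 2 * d ∧ ∃ r, j = i + 2 + 2 * r ∧
    ∃ m, d ≤ m + 1 ∧ InsertsBraid d m (standardColor d) (braidIII i r) L L'

/-- The braid of move IV: the pair of strands colored `(1 3)` makes a full twist with each of the two
neighboring pairs, both colored `(2 3)`, and a full twist in itself. -/
def braidIV (d : ℕ) : BraidWord :=
  pairFullTwist (2 * d - 6) ++ pairFullTwist (2 * d - 4) ++
    [(2 * d - 4, true), (2 * d - 4, true)]

/-- Move IV. -/
def MoveIV (d : ℕ) (L L' : Diagram) : Prop :=
  ∃ m, d ≤ m ∧ InsertsBraid d m (colorIV d) (braidIV d) L L'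

/-! ### Trivial sheets -/

/-- The `d - 2` unlinked unknots colored `(d-j  d+1+j)`, for `0 ≤ j ≤ d - 3`. -/
def sheets (d : ℕ) : Diagram :=
  (List.range (d - 2)).flatMap fun j => [.birth 0 (swap (d - j) (d + 1 + j)), .death 0]

/-! ### Tangles and local equivalence -/

/-! A trivial sheet serves as a pair of scissors. Let two parallel strands be colored `b = (q p)`,
and let an unknot be colored `a = (p p')`. Suppose the unknot forms a ring around them, running in
front of both strands and returning behind them. By move C three half twists of strands with colors
sharing one label are trivial, so two half twists equal one inverse half twist. Using this twice,
together with slides, turns the ring and the two strands into a minimum followed by a maximum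
colored `c = (q p')` (`ring`). Strands whose labels are disjoint from `p, p'` do not obstruct the
ring, because move N removes their clasps with it (`ring_all`).

A sheet placed below the link can be brought into this position (`cut`). One arc of it is pulled to
the far right in front of everything below the chosen level, which conjugates all colors there by
`a`, and then back to the left behind it, which changes no color there. Only the ring at the level
remains. That a strand can pass over or under an arbitrary tangle is checked slice by slice
(`Passable`).

At the insertion level the sheets cut the leftmost pairs one after another (`cut_pairs`). The pair
with largest labels `d-1-j, d-j` is cut by the sheet `(d-j d+1+j)`, and all remaining strands have
labels at most `d-1-j`, so the ring slips off them. The cuts depend on the level but not on what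
lies below it, so the same cuts apply to `L` and to `L'`. In `L'` the inserted braid then sits
directly below maxima. If these absorb it by isotopy, reversing the cuts finishes the proof
(`equiv_of_cap`). For move II the absorption is the first Reidemeister move. For move III the
threading avoids the maximum, the full twist of a maximum with a parallel pair comes off, and the
threading cancels against its inverse.

For move IV the first `d-3` sheets free the left side, and the last sheet `(3 2d-2)` remains. The
braid is conjugate to the full twist `P` of one pair around four strands, and `P = F x₀ F x₀`, where
`F` carries one strand of the pair around the four. Just after the first `F` the four strands are
colored `(1 2)`, so the pair `(1 3)` can be cut there. A maximum absorbs `x₀` and `P`, hence below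
it `x₀ F x₀` may be replaced by `F⁻¹`, and everything cancels (`equiv_braidIV`). -/

/-- All maxima of the diagram are colored by transpositions of `{1, …, d}`. -/
def Good (d : ℕ) (w : Diagram) : Prop :=
  ∀ i c, Piece.birth i c ∈ w → IsTransposition d c

theorem good_append {d : ℕ} {u v : Diagram} : Good d (u ++ v) ↔ Good d u ∧ Good d v := by
  simp only [Good, List.mem_append]
  exact ⟨fun h => ⟨fun i c m => h i c (.inl m), fun i c m => h i c (.inr m)⟩,
    fun h i c m => m.elim (h.1 i c) (h.2 i c)⟩

@[simp] theorem good_nil {d : ℕ} : Good d [] := by simp [Good]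

@[simp] theorem good_cross {d i : ℕ} {e : Bool} {w : Diagram} :
    Good d (.cross i e :: w) ↔ Good d w := by simp [Good]

@[simp] theorem good_death {d i : ℕ} {w : Diagram} :
    Good d (.death i :: w) ↔ Good d w := by simp [Good]

@[simp] theorem good_birth {d i : ℕ} {c : Color} {w : Diagram} :
    Good d (.birth i c :: w) ↔ IsTransposition d c ∧ Good d w := by
  simp only [Good, List.mem_cons, Piece.birth.injEq]
  exact ⟨fun h => ⟨h i c (.inl ⟨rfl, rfl⟩), fun j x m => h j x (.inr m)⟩,
    fun h j x m => m.elim (fun hh => hh.2 ▸ h.1) (h.2 j x)⟩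

theorem Runs.append {u v : Diagram} {s t r : List Color} (hu : Runs u s t) (hv : Runs v t r) :
    Runs (u ++ v) s r := by
  induction hu with
  | nil => exact hv
  | cons h _ ih => exact .cons h (ih hv)

theorem runs_cons {X : Piece} {w : Diagram} {s r : List Color} :
    Runs (X :: w) s r ↔ ∃ t, X.Acts s t ∧ Runs w t r :=
  ⟨fun h => by cases h with | cons h₁ h₂ => exact ⟨_, h₁, h₂⟩, fun ⟨_, h₁, h₂⟩ => .cons h₁ h₂⟩

@[simp] theorem runs_nil {s r : List Color} : Runs [] s r ↔ s = r :=
  ⟨fun h => by cases h; rfl, fun h => h ▸ .nil s⟩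

theorem runs_append {u v : Diagram} {s r : List Color} :
    Runs (u ++ v) s r ↔ ∃ t, Runs u s t ∧ Runs v t r := by
  refine ⟨fun h => ?_, fun ⟨t, h₁, h₂⟩ => h₁.append h₂⟩
  induction u generalizing s with
  | nil => exact ⟨s, .nil s, h⟩
  | cons X u ih =>
    obtain ⟨t, h₁, h₂⟩ := runs_cons.1 h
    obtain ⟨t', h₃, h₄⟩ := ih h₂
    exact ⟨t', .cons h₁ h₃, h₄⟩

/-- Maxima carry their color in the slice itself, so a diagram and its top colors determine all
lower levels. This is what allows a tangle to be split at a known level (`Tan.split`). -/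
theorem Piece.Acts.det {X : Piece} {s t t' : List Color} (h : X.Acts s t) (h' : X.Acts s t') :
    t = t' := by
  generalize hY : X = Y at h'
  generalize hs : s = s' at h'
  cases h <;> cases h' <;> simp only [Piece.birth.injEq, Piece.death.injEq, Piece.cross.injEq,
    reduceCtorEq, and_false] at hY
  all_goals
    obtain ⟨h₁, h₂⟩ := List.append_inj hs (by first | exact hY | exact hY.1)
    simp_all

theorem Runs.det {w : Diagram} {s t t' : List Color} (h : Runs w s t) (h' : Runs w s t') :
    t = t' := by
  induction h with
  | nil => simpa using h'
  | cons h₁ _ ih =>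
    obtain ⟨r, h₂, h₃⟩ := runs_cons.1 h'
    exact ih (h₁.det h₂ ▸ h₃)

/-! ### Tangles with further strands to the left or to the right. -/

/-- The same slice, `k` strands further to the right. -/
def Piece.shift (k : ℕ) : Piece → Piece
  | .birth i c => .birth (i + k) c
  | .death i => .death (i + k)
  | .cross i e => .cross (i + k) e

/-- The diagram moved to the right by `k` strands. -/
def shift (k : ℕ) (w : Diagram) : Diagram := w.map (Piece.shift k)

@[simp] theorem shift_nil (k : ℕ) : shift k [] = [] := rfl

@[simp] theorem shift_cons (k : ℕ) (X : Piece) (w : Diagram) :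
    shift k (X :: w) = X.shift k :: shift k w := rfl

@[simp] theorem shift_append (k : ℕ) (u v : Diagram) :
    shift k (u ++ v) = shift k u ++ shift k v := List.map_append

theorem shift_shift (k l : ℕ) (w : Diagram) : shift k (shift l w) = shift (l + k) w := by
  simp only [shift, List.map_map]
  congr 1
  funext X
  cases X <;> simp [Piece.shift, add_assoc]

theorem Piece.Acts.shift {X : Piece} {s t : List Color} (p : List Color) (h : X.Acts s t) :
    (X.shift p.length).Acts (p ++ s) (p ++ t) := by
  have e (r : List Color) : r.length + p.length = (p ++ r).length := by simp [add_comm]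
  cases h with
  | birth r q c => simpa [Piece.shift, e] using Piece.Acts.birth (p ++ r) q c
  | death r q c => simpa [Piece.shift, e] using Piece.Acts.death (p ++ r) q c
  | pos r q a b => simpa [Piece.shift, e] using Piece.Acts.pos (p ++ r) q a b
  | neg r q a b => simpa [Piece.shift, e] using Piece.Acts.neg (p ++ r) q a b

theorem Piece.Acts.suffix {X : Piece} {s t : List Color} (h : X.Acts s t) (q : List Color) :
    X.Acts (s ++ q) (t ++ q) := by
  cases h with
  | birth r q' c => simpa using Piece.Acts.birth r (q' ++ q) c
  | death r q' c => simpa using Piece.Acts.death r (q' ++ q) c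
  | pos r q' a b => simpa using Piece.Acts.pos r (q' ++ q) a b
  | neg r q' a b => simpa using Piece.Acts.neg r (q' ++ q) a b

/-- A consistently colored tangle diagram with colors `s` at its top and `t` at its bottom, all
of whose maxima are colored by transpositions of `{1, …, d}`. -/
structure Tan (d : ℕ) (w : Diagram) (s t : List Color) : Prop where
  runs : Runs w s t
  good : Good d w

theorem Tan.nil {d : ℕ} (s : List Color) : Tan d [] s s := ⟨.nil s, good_nil⟩

theorem Tan.append {d : ℕ} {u v : Diagram} {s t r : List Color} (hu : Tan d u s t)
    (hv : Tan d v t r) : Tan d (u ++ v) s r :=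
  ⟨hu.runs.append hv.runs, good_append.2 ⟨hu.good, hv.good⟩⟩

theorem tan_append {d : ℕ} {u v : Diagram} {s r : List Color} :
    Tan d (u ++ v) s r ↔ ∃ t, Tan d u s t ∧ Tan d v t r := by
  refine ⟨fun h => ?_, fun ⟨t, h₁, h₂⟩ => h₁.append h₂⟩
  obtain ⟨t, h₁, h₂⟩ := runs_append.1 h.runs
  have := good_append.1 h.good
  exact ⟨t, ⟨h₁, this.1⟩, ⟨h₂, this.2⟩⟩

theorem Tan.split {d : ℕ} {u v : Diagram} {s r t : List Color} (h : Tan d (u ++ v) s r)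
    (hu : Runs u s t) : Tan d u s t ∧ Tan d v t r := by
  obtain ⟨t', h₁, h₂⟩ := tan_append.1 h
  cases h₁.runs.det hu
  exact ⟨h₁, h₂⟩

theorem Tan.shift {d : ℕ} {w : Diagram} {s t : List Color} (p : List Color) (h : Tan d w s t) :
    Tan d (shift p.length w) (p ++ s) (p ++ t) := by
  obtain ⟨h, g⟩ := h
  induction h with
  | nil => exact .nil _
  | @cons X w s t r h₁ _ ih =>
    have g' : Good d [X] ∧ Good d w := good_append.1 (show Good d ([X] ++ w) from g)
    refine ⟨.cons (h₁.shift p) (ih g'.2).runs, (good_append (u := [X.shift p.length])).2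
      ⟨?_, (ih g'.2).good⟩⟩
    have := g'.1
    cases X <;> simp_all [Piece.shift]

theorem Tan.suffix {d : ℕ} {w : Diagram} {s t : List Color} (h : Tan d w s t) (q : List Color) :
    Tan d w (s ++ q) (t ++ q) := by
  obtain ⟨h, g⟩ := h
  refine ⟨?_, g⟩
  clear g
  induction h with
  | nil => exact .nil _
  | cons h₁ _ ih => exact .cons (h₁.suffix q) ih

/-! ### Elementary moves inside a larger tangle. -/

/-- An elementary isotopy or a move C or N at a level colored `s`. -/
def ElementaryMove (s : List Color) (l r : Diagram) : Prop :=
  Reidemeister l r ∨ MoveC s l r ∨ MoveN s l r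

theorem shift_moveTo (p : ℕ) (X : Piece) (k : ℕ) :
    (X.moveTo k).shift p = (X.shift p).moveTo (k + p) := by
  cases X <;> rfl

theorem Reidemeister.shift {l r : Diagram} (k : ℕ) (h : Reidemeister l r) :
    Reidemeister (_root_.shift k l) (_root_.shift k r) := by
  cases h with
  | exchange X Y m =>
    have h₁ : (X.shift k).position = X.position + k := by cases X <;> rfl
    have h₂ : (X.shift k).strandsOut = X.strandsOut := by cases X <;> rfl
    have h₃ : (X.shift k).strandsIn = X.strandsIn := by cases X <;> rfl
    have := Reidemeister.exchange (X.shift k) (Y.shift k) m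
    simp only [shift_cons, shift_nil, shift_moveTo]
    rw [h₁, h₂, h₃, show X.position + k + X.strandsOut + m = X.position + X.strandsOut + m + k by
      omega, show X.position + k + X.strandsIn + m = X.position + X.strandsIn + m + k by omega] at this
    exact this
  | zigzagLeft i c => simpa [Piece.shift, add_right_comm] using Reidemeister.zigzagLeft (i + k) c
  | zigzagRight i c => simpa [Piece.shift, add_right_comm] using Reidemeister.zigzagRight (i + k) c
  | slideBirth i c c' e =>
    simpa [Piece.shift, add_right_comm] using Reidemeister.slideBirth (i + k) c c' e
  | slideDeath i e => simpa [Piece.shift, add_right_comm] using Reidemeister.slideDeath (i + k) e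
  | twistBirth i c e => exact .twistBirth (i + k) c e
  | twistDeath i e => exact .twistDeath (i + k) e
  | cancel i e => exact .cancel (i + k) e
  | braid i => simpa [Piece.shift, add_right_comm] using Reidemeister.braid (i + k)

theorem ElementaryMove.shift {s : List Color} {l r : Diagram} (p : List Color)
    (h : ElementaryMove s l r) :
    ElementaryMove (p ++ s) (_root_.shift p.length l) (_root_.shift p.length r) := by
  have e (r : List Color) : r.length + p.length = (p ++ r).length := by simp [add_comm]
  rcases h with h | h | h
  · exact .inl (h.shift _)
  · obtain ⟨p', q, a, b, c, hab, hac, hbc⟩ := h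
    right; left
    simpa [_root_.shift, Piece.shift, e] using MoveC.mk (p ++ p') q a b c hab hac hbc
  · obtain ⟨p', q, a, b, c, e', h₁, h₂, h₃, h₄, h₅, h₆⟩ := h
    right; right
    simpa [_root_.shift, Piece.shift, e] using MoveN.mk (p ++ p') q a b c e' h₁ h₂ h₃ h₄ h₅ h₆

theorem ElementaryMove.suffix {s : List Color} {l r : Diagram} (h : ElementaryMove s l r)
    (q : List Color) : ElementaryMove (s ++ q) l r := by
  rcases h with h | h | h
  · exact .inl h
  · obtain ⟨p', q', a, b, c, hab, hac, hbc⟩ := h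
    right; left
    simpa using MoveC.mk p' (q' ++ q) a b c hab hac hbc
  · obtain ⟨p', q', a, b, c, e', h₁, h₂, h₃, h₄, h₅, h₆⟩ := h
    right; right
    simpa using MoveN.mk p' (q' ++ q) a b c e' h₁ h₂ h₃ h₄ h₅ h₆

/-- One elementary move inside a tangle diagram with colors `s` at its top and `t` at its
bottom. -/
inductive LocalStep (d : ℕ) : List Color → List Color → Diagram → Diagram → Prop
  | mk {u l r v : Diagram} {s s' t' t : List Color} (hu : Tan d u s s') (hl : Tan d l s' t')
      (hr : Tan d r s' t') (hv : Tan d v t' t) (h : ElementaryMove s' l r) :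
      LocalStep d s t (u ++ l ++ v) (u ++ r ++ v)

/-- Equivalence of tangle diagrams with colors `s` at the top and `t` at the bottom. -/
def TangleEquiv (d : ℕ) (s t : List Color) : Diagram → Diagram → Prop :=
  Relation.EqvGen (LocalStep d s t)

namespace TangleEquiv

variable {d : ℕ} {s t s' t' : List Color} {w w' w'' u v l r : Diagram}

theorem refl (w : Diagram) : TangleEquiv d s t w w := Relation.EqvGen.refl _

theorem of_step (h : LocalStep d s t w w') : TangleEquiv d s t w w' := Relation.EqvGen.rel _ _ h

theorem symm (h : TangleEquiv d s t w w') : TangleEquiv d s t w' w := Relation.EqvGen.symm _ _ h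

theorem trans (h : TangleEquiv d s t w w') (h' : TangleEquiv d s t w' w'') :
    TangleEquiv d s t w w'' := Relation.EqvGen.trans _ _ _ h h'

/-- A `LocalStep` contains the consistency of both of its sides, so the coloring of one diagram of
an equivalence never has to be recomputed for the other. -/
theorem tan_iff (h : TangleEquiv d s t w w') : Tan d w s t ↔ Tan d w' s t := by
  induction h with
  | rel _ _ h =>
    obtain ⟨hu, hl, hr, hv, _⟩ := h
    exact ⟨fun _ => (hu.append hr).append hv, fun _ => (hu.append hl).append hv⟩
  | refl => rfl
  | symm _ _ _ ih => exact ih.symm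
  | trans _ _ _ _ _ ih₁ ih₂ => exact ih₁.trans ih₂

theorem of_move (hl : Tan d l s t) (hr : Tan d r s t) (h : ElementaryMove s l r) :
    TangleEquiv d s t l r := by
  simpa using of_step (LocalStep.mk (.nil s) hl hr (.nil t) h)

theorem ctx (hu : Tan d u s s') (h : TangleEquiv d s' t' l r) (hv : Tan d v t' t) :
    TangleEquiv d s t (u ++ (l ++ v)) (u ++ (r ++ v)) := by
  induction h with
  | rel _ _ h =>
    obtain ⟨hu', hl, hr, hv', h⟩ := h
    simpa using of_step (LocalStep.mk (hu.append hu') hl hr (hv'.append hv) h)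
  | refl => exact .refl _
  | symm _ _ _ ih => exact ih.symm
  | trans _ _ _ _ _ ih₁ ih₂ => exact ih₁.trans ih₂

theorem left (hu : Tan d u s s') (h : TangleEquiv d s' t l r) :
    TangleEquiv d s t (u ++ l) (u ++ r) := by
  simpa using h.ctx hu (.nil t)

theorem right (h : TangleEquiv d s t' l r) (hv : Tan d v t' t) :
    TangleEquiv d s t (l ++ v) (r ++ v) := h.ctx (.nil s) hv

theorem shift (p : List Color) (h : TangleEquiv d s t w w') :
    TangleEquiv d (p ++ s) (p ++ t) (shift p.length w) (_root_.shift p.length w') := by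
  induction h with
  | rel _ _ h =>
    obtain ⟨hu, hl, hr, hv, h⟩ := h
    simpa using of_step
      (LocalStep.mk (hu.shift p) (hl.shift p) (hr.shift p) (hv.shift p) (h.shift p))
  | refl => exact .refl _
  | symm _ _ _ ih => exact ih.symm
  | trans _ _ _ _ _ ih₁ ih₂ => exact ih₁.trans ih₂

theorem suffix (h : TangleEquiv d s t w w') (q : List Color) :
    TangleEquiv d (s ++ q) (t ++ q) w w' := by
  induction h with
  | rel _ _ h =>
    obtain ⟨hu, hl, hr, hv, h⟩ := h
    exact of_step
      (LocalStep.mk (hu.suffix q) (hl.suffix q) (hr.suffix q) (hv.suffix q) (h.suffix q))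
  | refl => exact .refl _
  | symm _ _ _ ih => exact ih.symm
  | trans _ _ _ _ _ ih₁ ih₂ => exact ih₁.trans ih₂

/-- A tangle without ends is a closed link, and a `LocalStep` then holds exactly the data that a
`Step` requires. -/
theorem cnEquivalent (h : TangleEquiv d [] [] w w') : CNEquivalent d w w' := by
  induction h with
  | rel _ _ h =>
    generalize hs : ([] : List Color) = s at h
    generalize ht : s = t at h
    have hst : ([] : List Color) = t := hs.trans ht
    clear ht
    obtain ⟨hu, hl, hr, hv, h⟩ := h
    subst hs hst
    have h₁ := (hu.append hl).append hv
    have h₂ := (hu.append hr).append hv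
    exact .rel _ _ ⟨⟨h₁.runs, h₁.good⟩, ⟨h₂.runs, h₂.good⟩, _, _, _, _, _, _, rfl, rfl, hu.runs,
      hl.runs, hr.runs, h⟩
  | refl => exact .refl _
  | symm _ _ _ ih => exact .symm _ _ ih
  | trans _ _ _ _ _ ih₁ ih₂ => exact .trans _ _ _ ih₁ ih₂

end TangleEquiv

/-! ### Slices at explicit positions -/

@[simp] theorem acts_pos_zero {a b : Color} {q t : List Color} :
    Piece.Acts (.cross 0 true) (a :: b :: q) t ↔ (a * b * a⁻¹) :: a :: q = t :=
  ⟨fun h => (Piece.Acts.pos [] q a b).det h, fun h => h ▸ Piece.Acts.pos [] q a b⟩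

@[simp] theorem acts_neg_zero {a b : Color} {q t : List Color} :
    Piece.Acts (.cross 0 false) (a :: b :: q) t ↔ b :: (b * a * b⁻¹) :: q = t :=
  ⟨fun h => (Piece.Acts.neg [] q a b).det h, fun h => h ▸ Piece.Acts.neg [] q a b⟩

@[simp] theorem acts_birth_zero {c : Color} {q t : List Color} :
    Piece.Acts (.birth 0 c) q t ↔ c :: c :: q = t :=
  ⟨fun h => (Piece.Acts.birth [] q c).det h, fun h => h ▸ Piece.Acts.birth [] q c⟩

@[simp] theorem acts_death_zero {a b : Color} {q t : List Color} :
    Piece.Acts (.death 0) (a :: b :: q) t ↔ b = a ∧ q = t := by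
  constructor
  · intro h
    generalize hs : a :: b :: q = s at h
    generalize hX : Piece.death 0 = X at h
    cases h <;> try cases hX
    rename_i p _ _
    cases p
    · simp_all
    · simp at hX
  · rintro ⟨rfl, rfl⟩
    exact Piece.Acts.death [] q b

/-- Stripping untouched strands from the left reduces every slice at a numeral position to position
`0`; in this way `simp` computes the colors of explicit tangles. -/
theorem acts_shift_one {X : Piece} {x : Color} {s t : List Color} :
    (X.shift 1).Acts (x :: s) t ↔ ∃ t', X.Acts s t' ∧ x :: t' = t := by
  constructor
  · intro h
    generalize hs : x :: s = s' at h
    generalize hX : X.shift 1 = Y at h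
    cases h with
    | birth p q c =>
      cases p with
      | nil => cases X <;> simp [Piece.shift] at hX
      | cons y p =>
        obtain ⟨rfl, rfl⟩ : x = y ∧ s = p ++ q := by simpa using hs
        cases X <;> simp [Piece.shift] at hX
        obtain ⟨rfl, rfl⟩ := hX
        exact ⟨_, .birth p q _, rfl⟩
    | death p q c =>
      cases p with
      | nil => cases X <;> simp [Piece.shift] at hX
      | cons y p =>
        obtain ⟨rfl, rfl⟩ : x = y ∧ s = p ++ c :: c :: q := by simpa using hs
        cases X <;> simp [Piece.shift] at hX
        subst hX
        exact ⟨_, .death p q _, rfl⟩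
    | pos p q a b =>
      cases p with
      | nil => cases X <;> simp [Piece.shift] at hX
      | cons y p =>
        obtain ⟨rfl, rfl⟩ : x = y ∧ s = p ++ a :: b :: q := by simpa using hs
        cases X <;> simp [Piece.shift] at hX
        obtain ⟨rfl, rfl⟩ := hX
        exact ⟨_, .pos p q _ _, rfl⟩
    | neg p q a b =>
      cases p with
      | nil => cases X <;> simp [Piece.shift] at hX
      | cons y p =>
        obtain ⟨rfl, rfl⟩ : x = y ∧ s = p ++ a :: b :: q := by simpa using hs
        cases X <;> simp [Piece.shift] at hX
        obtain ⟨rfl, rfl⟩ := hX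
        exact ⟨_, .neg p q _ _, rfl⟩
  · rintro ⟨t', h, rfl⟩
    exact h.shift [x]

@[simp] theorem acts_cross_succ {i : ℕ} {e : Bool} {x : Color} {s t : List Color} :
    Piece.Acts (.cross (i + 1) e) (x :: s) t ↔ ∃ t', Piece.Acts (.cross i e) s t' ∧ x :: t' = t :=
  acts_shift_one (X := .cross i e)

@[simp] theorem acts_birth_succ {i : ℕ} {c : Color} {x : Color} {s t : List Color} :
    Piece.Acts (.birth (i + 1) c) (x :: s) t ↔ ∃ t', Piece.Acts (.birth i c) s t' ∧ x :: t' = t :=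
  acts_shift_one (X := .birth i c)

@[simp] theorem acts_death_succ {i : ℕ} {x : Color} {s t : List Color} :
    Piece.Acts (.death (i + 1)) (x :: s) t ↔ ∃ t', Piece.Acts (.death i) s t' ∧ x :: t' = t :=
  acts_shift_one (X := .death i)

attribute [simp] runs_cons

/-! ### Local moves in their leftmost position -/

theorem IsTransposition.mul_self {d : ℕ} {c : Color} (h : IsTransposition d c) : c * c = 1 := by
  obtain ⟨a, b, -, -, -, rfl⟩ := h
  exact swap_mul_self a b

theorem isTransposition_swap {d a b : ℕ} (ha : 1 ≤ a) (hb : 1 ≤ b) (had : a ≤ d) (hbd : b ≤ d)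
    (hab : a ≠ b) : IsTransposition d (swap a b) := by
  rcases lt_or_gt_of_ne hab with h | h
  · exact ⟨a, b, ha, h, hbd, rfl⟩
  · exact ⟨b, a, hb, h, had, swap_comm a b⟩

theorem IsTransposition.swap_apply {d x a b : ℕ} (ha : 1 ≤ a) (hb : 1 ≤ b) (had : a ≤ d)
    (hbd : b ≤ d) (hx : 1 ≤ x) (hxd : x ≤ d) : 1 ≤ swap a b x ∧ swap a b x ≤ d := by
  rw [swap_apply_def]
  split_ifs <;> omega

theorem IsTransposition.conj {d : ℕ} {c g : Color} (hg : IsTransposition d g)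
    (hc : IsTransposition d c) : IsTransposition d (g * c * g⁻¹) := by
  obtain ⟨a, b, ha, hab, hb, rfl⟩ := hc
  obtain ⟨x, y, hx, hxy, hy, rfl⟩ := hg
  rw [← swap_apply_apply]
  have h₁ := IsTransposition.swap_apply hx (hx.trans hxy.le) (hxy.le.trans hy) hy ha
    (hab.le.trans hb)
  have h₂ := IsTransposition.swap_apply hx (hx.trans hxy.le) (hxy.le.trans hy) hy
    (ha.trans hab.le) hb
  exact isTransposition_swap h₁.1 h₂.1 h₁.2 h₂.2 ((swap x y).injective.ne hab.ne)

theorem inv_of_mul_self {c : Color} (h : c * c = 1) : c⁻¹ = c := inv_eq_of_mul_eq_one_right h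

theorem mul_self_mul {c : Color} (h : c * c = 1) (x : Color) : c * (c * x) = x := by
  rw [← mul_assoc, h, one_mul]

theorem conj_mul_self {c g : Color} (h : c * c = 1) : (g * c * g⁻¹) * (g * c * g⁻¹) = 1 := by
  simp [mul_assoc, mul_self_mul h]

namespace TangleEquiv

variable {d : ℕ}

/-- At both signs the under-strand is conjugated by the over-strand itself, not by its inverse at
one of them. The second crossing therefore restores the colors only because colors are involutions.
-/
theorem cancel {a b : Color} (ha : a * a = 1) (hb : b * b = 1) (e : Bool) :
    TangleEquiv d [a, b] [a, b] [.cross 0 e, .cross 0 (!e)] [] := by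
  refine of_move ⟨?_, by simp⟩ (.nil _) (.inl (.cancel 0 e))
  cases e <;> simp [mul_assoc, inv_of_mul_self, mul_self_mul, ha, hb]

theorem braid (a b c : Color) :
    TangleEquiv d [a, b, c] [a * b * a⁻¹ * (a * c * a⁻¹) * (a * b * a⁻¹)⁻¹, a * b * a⁻¹, a]
      [.cross 0 true, .cross 1 true, .cross 0 true]
      [.cross 1 true, .cross 0 true, .cross 1 true] :=
  of_move ⟨by simp, by simp⟩ ⟨by simp [mul_assoc], by simp⟩ (.inl (.braid 0))

theorem slideBirth_over {x c : Color} (hc : IsTransposition d c) :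
    TangleEquiv d [x] [c, c * x * c⁻¹, c] [.birth 0 c, .cross 1 true] [.birth 1 c, .cross 0 false] :=
  of_move ⟨by simp, by simpa⟩ ⟨by simp, by simpa⟩ (.inl (.slideBirth 0 c c true))

theorem slideBirth_under {x c : Color} (hx : IsTransposition d x) (hc : IsTransposition d c) :
    TangleEquiv d [x] [c, x, x * c * x⁻¹] [.birth 0 c, .cross 1 false]
      [.birth 1 (x * c * x⁻¹), .cross 0 true] := by
  have h := hx.mul_self
  exact of_move ⟨by simp, by simpa⟩
    ⟨by simp [mul_assoc, inv_of_mul_self, mul_self_mul, h], by simpa using hx.conj hc⟩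
    (.inl (.slideBirth 0 c _ false))

theorem slideDeath_pos {b c : Color} (hb : b * b = 1) :
    TangleEquiv d [b * c * b⁻¹, b, c] [b] [.cross 1 true, .death 0] [.cross 0 false, .death 1] :=
  of_move ⟨by simp, by simp⟩ ⟨by simp [mul_assoc, inv_of_mul_self, mul_self_mul, hb], by simp⟩ (.inl (.slideDeath 0 true))

theorem slideDeath_neg (b c : Color) :
    TangleEquiv d [c, b, c] [c * b * c⁻¹] [.cross 1 false, .death 0] [.cross 0 true, .death 1] :=
  of_move ⟨by simp, by simp⟩ ⟨by simp, by simp⟩ (.inl (.slideDeath 0 false))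

theorem twistBirth {c : Color} (hc : IsTransposition d c) (e : Bool) :
    TangleEquiv d [] [c, c] [.birth 0 c, .cross 0 e] [.birth 0 c] :=
  of_move ⟨by cases e <;> simp, by simpa⟩ ⟨by simp, by simpa⟩ (.inl (.twistBirth 0 c e))

theorem inside {s t s' t' : List Color} {u v l r : Diagram} (h : TangleEquiv d s' t' l r)
    (p q : List Color) (hu : Tan d u s (p ++ (s' ++ q))) (hv : Tan d v (p ++ (t' ++ q)) t) :
    TangleEquiv d s t (u ++ (_root_.shift p.length l ++ v))
      (u ++ (_root_.shift p.length r ++ v)) :=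
  ((h.suffix q).shift p).ctx hu hv

theorem exchange {X Y : Piece} {s t s' t' : List Color} (hX : Tan d [X] s t)
    (hY : Tan d [Y] s' t') :
    TangleEquiv d (s ++ s') (t ++ t') ([X] ++ _root_.shift t.length [Y])
      (_root_.shift s.length [Y] ++ [X]) := by
  refine of_move ((hX.suffix s').append (hY.shift t)) ((hY.shift s).append (hX.suffix t'))
    (.inl ?_)
  -- `k` counts the strands of the left block to the right of those that `X` touches.
  obtain ⟨k, h₁, h₂⟩ : ∃ k, s.length = X.position + X.strandsIn + k ∧
      t.length = X.position + X.strandsOut + k := by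
    obtain ⟨t₀, h, h'⟩ := runs_cons.1 hX.runs
    cases runs_nil.1 h'
    cases h with
    | birth p q c => exact ⟨q.length, by simp [Piece.position, Piece.strandsIn],
        by simp [Piece.position, Piece.strandsOut]; omega⟩
    | death p q c => exact ⟨q.length, by simp [Piece.position, Piece.strandsIn]; omega,
        by simp [Piece.position, Piece.strandsOut]⟩
    | pos p q a b => exact ⟨q.length, by simp [Piece.position, Piece.strandsIn]; omega,
        by simp [Piece.position, Piece.strandsOut]; omega⟩
    | neg p q a b => exact ⟨q.length, by simp [Piece.position, Piece.strandsIn]; omega,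
        by simp [Piece.position, Piece.strandsOut]; omega⟩
  have h (m : ℕ) : Y.shift m = Y.moveTo (Y.position + m) := by cases Y <;> rfl
  have := Reidemeister.exchange X Y (k + Y.position)
  have e₁ : X.position + X.strandsOut + (k + Y.position) = Y.position + t.length := by omega
  have e₂ : X.position + X.strandsIn + (k + Y.position) = Y.position + s.length := by omega
  rw [e₁, e₂, ← h, ← h] at this
  exact this

/-- Side-by-side tangles may be moved vertically past each other: induction over the slices of both,
with `exchange` for one slice against one slice. -/
theorem interchange {w w' : Diagram} {s t s' t' : List Color} (hw : Tan d w s t)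
    (hw' : Tan d w' s' t') :
    TangleEquiv d (s ++ s') (t ++ t') (w ++ _root_.shift t.length w')
      (_root_.shift s.length w' ++ w) := by
  have one {X : Piece} {s t : List Color} (hX : Tan d [X] s t) : ∀ {w' s'}, Tan d w' s' t' →
      TangleEquiv d (s ++ s') (t ++ t') ([X] ++ _root_.shift t.length w')
        (_root_.shift s.length w' ++ [X]) := by
    intro w'
    induction w' with
    | nil => exact fun _ => .refl _
    | cons Y w' ih =>
      intro s' hw'
      obtain ⟨r, hY, hw'⟩ := (tan_append (u := [Y])).1 hw'
      have h₁ := (exchange hX hY).right (hw'.shift t)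
      have h₂ := (ih hw').left (hY.shift s)
      simpa using h₁.trans (by simpa using h₂)
  induction w generalizing s with
  | nil =>
    cases runs_nil.1 hw.runs
    simpa using TangleEquiv.refl _
  | cons X w ih =>
    obtain ⟨r, hX, hw⟩ := (tan_append (u := [X])).1 hw
    have h₁ := (ih hw).left (hX.suffix s')
    have h₂ := (one hX hw').right (hw.suffix t')
    simpa using h₁.trans (by simpa using h₂)

end TangleEquiv

/-! ### Consequences of move C for the transpositions of three labels. -/

/-- The triples of transpositions of three labels. -/
structure Dihedral (d : ℕ) (a b c : Color) : Prop where
  left : IsTransposition d a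
  mid : IsTransposition d b
  right : IsTransposition d c
  exists_labels : ∃ x y z : ℕ, x ≠ y ∧ x ≠ z ∧ y ≠ z ∧ a = swap x y ∧ b = swap y z ∧ c = swap x z

namespace Dihedral

variable {d : ℕ} {a b c : Color}

/-- With `flip` this generates all orders of the triple, so the single computation `conj` yields all
six conjugations. -/
theorem rotate (h : Dihedral d a b c) : Dihedral d b c a := by
  obtain ⟨ha, hb, hc, x, y, z, hxy, hxz, hyz, h₁, h₂, h₃⟩ := h
  exact ⟨hb, hc, ha, y, z, x, hyz, hxy.symm, hxz.symm, h₂, h₃.trans (swap_comm _ _),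
    h₁.trans (swap_comm _ _)⟩

theorem flip (h : Dihedral d a b c) : Dihedral d b a c := by
  obtain ⟨ha, hb, hc, x, y, z, hxy, hxz, hyz, h₁, h₂, h₃⟩ := h
  exact ⟨hb, ha, hc, z, y, x, hyz.symm, hxz.symm, hxy.symm, h₂.trans (swap_comm _ _),
    h₁.trans (swap_comm _ _), h₃.trans (swap_comm _ _)⟩

theorem conj (h : Dihedral d a b c) : a * b * a⁻¹ = c := by
  obtain ⟨-, -, -, x, y, z, hxy, hxz, hyz, rfl, rfl, rfl⟩ := h
  rw [← swap_apply_apply]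
  rw [swap_apply_right, swap_apply_of_ne_of_ne hxz.symm hyz.symm]

theorem cube (h : Dihedral d a b c) :
    TangleEquiv d [a, b] [a, b] [.cross 0 true, .cross 0 true, .cross 0 true] [] := by
  refine .of_move ⟨?_, by simp⟩ (.nil _) (.inr (.inl ?_))
  · simp [h.conj, h.rotate.conj, h.rotate.rotate.conj]
  · obtain ⟨-, -, -, x, y, z, hxy, hxz, hyz, rfl, rfl, rfl⟩ := h
    exact MoveC.mk [] [] x y z hxy hxz hyz

end Dihedral

namespace TangleEquiv

variable {d : ℕ} {a b c : Color}

/-- Three half twists are trivial by move C, so the square of a half twist is its inverse. -/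
theorem twist_twist (h : Dihedral d a b c) :
    TangleEquiv d [a, b] [b, c] [.cross 0 true, .cross 0 true] [.cross 0 false] := by
  have h₁ := h.conj
  have h₂ := h.rotate.rotate.conj
  have h₃ := h.rotate.conj
  have h₄ := h.flip.conj
  have e₁ := (cancel (d := d) h.mid.mul_self h.right.mul_self true).left (s := [a, b])
    (u := [.cross 0 true, .cross 0 true]) ⟨by simp [h₁, h₂], by simp⟩
  have e₂ := h.cube.right (v := [.cross 0 false]) (t := [b, c]) ⟨by simp [h₄], by simp⟩
  exact e₁.symm.trans e₂

theorem untwist_untwist (h : Dihedral d a b c) :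
    TangleEquiv d [a, b] [c, a] [.cross 0 false, .cross 0 false] [.cross 0 true] := by
  have h₁ := h.conj
  have h₂ := h.rotate.rotate.conj
  have h₃ := h.rotate.conj
  have h₄ := h.flip.conj
  have h₅ := h.rotate.flip.conj
  have e₁ := h.cube.right (v := [.cross 0 false, .cross 0 false]) (t := [c, a])
    ⟨by simp [h₄, h₅], by simp⟩
  have e₂ := (cancel (d := d) h.mid.mul_self h.right.mul_self true).ctx (s := [a, b])
    (t := [c, a]) (u := [.cross 0 true, .cross 0 true]) (v := [.cross 0 false])
    ⟨by simp [h₁, h₂], by simp⟩ ⟨by simp [h₅], by simp⟩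
  have e₃ := (cancel (d := d) h.right.mul_self h.left.mul_self true).left (s := [a, b])
    (u := [.cross 0 true]) ⟨by simp [h₁], by simp⟩
  exact e₁.symm.trans <| e₂.trans e₃

/-- An unknot around two strands, in front of them and then behind them, joins the strands and
changes their colors. -/
theorem ring (h : Dihedral d a b c) :
    TangleEquiv d [b, b] [c, c]
      [.birth 0 a, .cross 1 true, .cross 2 true, .cross 2 true, .cross 1 true, .death 0]
      [.death 0, .birth 0 c] := by
  have h₁ := h.conj
  have h₂ := h.rotate.rotate.conj
  have h₃ := h.rotate.conj
  have h₄ := h.flip.conj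
  have h₅ := h.rotate.flip.conj
  have h₆ := h.rotate.rotate.flip.conj
  have ha := h.left
  have hb := h.mid
  have hc := h.right
  -- The clasp of the ring with the right strand becomes one negative crossing. The ring's maximum
  -- and minimum can then slide over to the left strand (`s₂`, `s₃`).
  have s₁ := (twist_twist h).inside (s := [b, b]) (t := [c, c]) [a, c] []
    (u := [.birth 0 a, .cross 1 true]) (v := [.cross 1 true, .death 0])
    ⟨by simp [*], by simp [*]⟩ ⟨by simp [*], by simp [*]⟩
  have s₂ := (slideBirth_over (x := b) ha).inside (s := [b, b]) (t := [c, c]) [] [b]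
    (u := []) (v := [.cross 2 false, .cross 1 true, .death 0])
    ⟨by simp [*], by simp [*]⟩ ⟨by simp [*], by simp [*]⟩
  have s₃ := (slideDeath_pos (d := d) (b := c) (c := b) hc.mul_self).inside (s := [b, b])
    (t := [c, c]) [] [c] (u := [.birth 1 a, .cross 0 false, .cross 2 false]) (v := [])
    ⟨by simp [*], by simp [*]⟩ ⟨by simp [*], by simp [*]⟩
  have s₄ := (interchange (d := d) (w := [.cross 0 false]) (w' := [.cross 0 false])
    (s := [a, c]) (s' := [a, b]) (t := [c, b]) (t' := [b, c]) ⟨by simp [*], by simp⟩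
    ⟨by simp [*], by simp⟩).inside (s := [b, b]) (t := [c, c]) [] []
    (u := [.birth 1 a, .cross 0 false]) (v := [.death 1])
    ⟨by simp [*], by simp [*]⟩ ⟨by simp [*], by simp [*]⟩
  -- After `s₄` the two negative crossings on the left are adjacent, and move C makes them one
  -- positive crossing. The maximum now slides back with its new color `c`, the minimum slides to
  -- the right, and the last two crossings cancel.
  have s₅ := (untwist_untwist h.flip).inside (s := [b, b])
    (t := [c, c]) [] [a, b] (u := [.birth 1 a]) (v := [.cross 2 false, .death 1])
    ⟨by simp [*], by simp [*]⟩ ⟨by simp [*], by simp [*]⟩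
  have s₆ := (slideBirth_under hb hc).inside (s := [b, b])
    (t := [c, c]) [] [b] (u := []) (v := [.cross 2 false, .death 1])
    ⟨by simp [*], by simp [*]⟩ ⟨by simp [*], by simp [*]⟩
  have s₇ := (slideDeath_neg (d := d) a b).inside (s := [b, b])
    (t := [c, c]) [c] [] (u := [.birth 0 c, .cross 1 false]) (v := [])
    ⟨by simp [*], by simp [*]⟩ ⟨by simp [*], by simp [*]⟩
  have s₈ := (cancel (d := d) hc.mul_self hb.mul_self false).inside (s := [b, b])
    (t := [c, c]) [c] [b] (u := [.birth 0 c]) (v := [.death 2])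
    ⟨by simp [*], by simp [*]⟩ ⟨by simp [*], by simp [*]⟩
  have s₉ := (interchange (d := d) (w := [.birth 0 c]) (w' := [.death 0])
    (s := []) (s' := [b, b]) (t := [c, c]) (t' := []) ⟨by simp [*], by simp [*]⟩
    ⟨by simp [*], by simp⟩)
  rw [h₃] at s₆
  exact s₁.trans <| s₂.trans <| s₃.trans <| s₄.symm.trans <| s₅.trans <| s₆.symm.trans <|
    s₇.trans <| s₈.trans s₉

end TangleEquiv

/-! ### Braid words -/

/-- The braid words `w` and `w'` on `n` strands are equivalent, whatever the colors. -/
def BraidEquiv (d n : ℕ) (w w' : BraidWord) : Prop :=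
  ∀ s : List Color, s.length = n → (∀ x ∈ s, IsTransposition d x) →
    ∃ t : List Color, t.length = n ∧ (∀ x ∈ t, IsTransposition d x) ∧ Tan d w.toDiagram s t ∧
      Tan d w'.toDiagram s t ∧ TangleEquiv d s t w.toDiagram w'.toDiagram

theorem BraidWord.toDiagram_append (w w' : BraidWord) :
    BraidWord.toDiagram (w ++ w') = w.toDiagram ++ w'.toDiagram := List.map_append

theorem BraidWord.good_toDiagram {d : ℕ} (w : BraidWord) : Good d w.toDiagram := by
  intro i c h
  simp [BraidWord.toDiagram] at h

namespace BraidEquiv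

variable {d n : ℕ} {u v w w' w'' : BraidWord}

theorem symm (h : BraidEquiv d n w w') : BraidEquiv d n w' w := fun s hs hs' => by
  obtain ⟨t, h₁, h₂, h₃, h₄, h₅⟩ := h s hs hs'
  exact ⟨t, h₁, h₂, h₄, h₃, h₅.symm⟩

theorem trans (h : BraidEquiv d n w w') (h' : BraidEquiv d n w' w'') :
    BraidEquiv d n w w'' := fun s hs hs' => by
  obtain ⟨t, h₁, h₂, h₃, h₄, h₅⟩ := h s hs hs'
  obtain ⟨t', -, -, k₃, k₄, k₅⟩ := h' s hs hs'
  cases h₄.runs.det k₃.runs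
  exact ⟨t, h₁, h₂, h₃, k₄, h₅.trans k₅⟩

theorem append {v' : BraidWord} (h : BraidEquiv d n w w') (h' : BraidEquiv d n v v') :
    BraidEquiv d n (w ++ v) (w' ++ v') := fun s hs hs' => by
  obtain ⟨t, h₁, h₂, h₃, h₄, h₅⟩ := h s hs hs'
  obtain ⟨r, k₁, k₂, k₃, k₄, k₅⟩ := h' t h₁ h₂
  simp only [BraidWord.toDiagram_append]
  exact ⟨r, k₁, k₂, h₃.append k₃, h₄.append k₄, (h₅.right k₃).trans (k₅.left h₄)⟩

theorem single {i : ℕ} (e : Bool) (hi : i + 1 < n) : BraidEquiv d n [(i, e)] [(i, e)] := by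
  intro s hs hs'
  obtain ⟨p, a, b, q, rfl, rfl⟩ : ∃ p a b q, s = p ++ a :: b :: q ∧ p.length = i :=
    ⟨s.take i, s[i], s[i + 1], s.drop (i + 2), by simp, by simp; omega⟩
  have ha := hs' a (by simp)
  have hb := hs' b (by simp)
  cases e with
  | true =>
    refine ⟨_, ?_, ?_, ⟨.cons (.pos p q a b) (.nil _), BraidWord.good_toDiagram _⟩,
      ⟨.cons (.pos p q a b) (.nil _), BraidWord.good_toDiagram _⟩, .refl _⟩
    · simpa using hs
    · simp only [List.mem_append, List.mem_cons] at hs' ⊢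
      rintro x (h | rfl | rfl | h)
      · exact hs' _ (.inl h)
      · exact ha.conj hb
      · exact ha
      · exact hs' _ (.inr (.inr (.inr h)))
  | false =>
    refine ⟨_, ?_, ?_, ⟨.cons (.neg p q a b) (.nil _), BraidWord.good_toDiagram _⟩,
      ⟨.cons (.neg p q a b) (.nil _), BraidWord.good_toDiagram _⟩, .refl _⟩
    · simpa using hs
    · simp only [List.mem_append, List.mem_cons] at hs' ⊢
      rintro x (h | rfl | rfl | h)
      · exact hs' _ (.inl h)
      · exact hb
      · exact hb.conj ha
      · exact hs' _ (.inr (.inr (.inr h)))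

theorem refl (hw : ∀ x ∈ w, x.1 + 1 < n) : BraidEquiv d n w w := by
  induction w with
  | nil => exact fun s hs hs' => ⟨s, hs, hs', .nil s, .nil s, .refl _⟩
  | cons x w ih =>
    exact (single x.2 (hw x (by simp))).append (w := [x]) (ih fun y hy => hw y (by simp [hy]))

theorem cancel {i : ℕ} (e : Bool) (hi : i + 1 < n) :
    BraidEquiv d n [(i, e), (i, !e)] [] := by
  intro s hs hs'
  obtain ⟨p, a, b, q, rfl, rfl⟩ : ∃ p a b q, s = p ++ a :: b :: q ∧ p.length = i :=
    ⟨s.take i, s[i], s[i + 1], s.drop (i + 2), by simp, by simp; omega⟩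
  have ha := hs' a (by simp)
  have hb := hs' b (by simp)
  have h := ((TangleEquiv.cancel (d := d) ha.mul_self hb.mul_self e).suffix q).shift p
  simp only [shift_cons, shift_nil, Piece.shift, zero_add] at h
  exact ⟨_, hs, hs', h.tan_iff.2 (.nil _), .nil _, h⟩

theorem braid {i : ℕ} (hi : i + 2 < n) : BraidEquiv d n
    [(i, true), (i + 1, true), (i, true)] [(i + 1, true), (i, true), (i + 1, true)] := by
  intro s hs hs'
  obtain ⟨t, h₁, h₂, h₃, -⟩ := refl (d := d) (n := n) (w := [(i, true), (i + 1, true), (i, true)])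
    (by simp; omega) s hs hs'
  obtain ⟨p, a, b, c, q, rfl, rfl⟩ : ∃ p a b c q, s = p ++ a :: b :: c :: q ∧ p.length = i :=
    ⟨s.take i, s[i], s[i + 1], s[i + 2], s.drop (i + 3), by simp, by simp; omega⟩
  have h := ((TangleEquiv.braid (d := d) a b c).suffix q).shift p
  simp only [shift_cons, shift_nil, Piece.shift, zero_add, add_comm 1] at h
  have k : Tan d [.cross 0 true, .cross 1 true, .cross 0 true] [a, b, c]
      [a * b * a⁻¹ * (a * c * a⁻¹) * (a * b * a⁻¹)⁻¹, a * b * a⁻¹, a] :=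
    ⟨by simp, by simp⟩
  replace k := (k.suffix q).shift p
  simp only [shift_cons, shift_nil, Piece.shift, zero_add, add_comm 1] at k
  cases k.runs.det h₃.runs
  exact ⟨_, h₁, h₂, h₃, h.tan_iff.1 h₃, h⟩

theorem far {i j : ℕ} (e e' : Bool) (hij : i + 2 ≤ j) (hj : j + 1 < n) :
    BraidEquiv d n [(i, e), (j, e')] [(j, e'), (i, e)] := by
  intro s hs hs'
  obtain ⟨t₁, h₁, h₂, h₃, -⟩ := single (d := d) (n := i + 2) (i := i) e (by omega) (s.take (i + 2))
    (by simp; omega) (fun x hx => hs' x (List.mem_of_mem_take hx))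
  obtain ⟨t₂, k₁, k₂, k₃, -⟩ := single (d := d) (n := n - (i + 2)) (i := j - (i + 2)) e' (by omega)
    (s.drop (i + 2)) (by simp; omega) (fun x hx => hs' x (List.mem_of_mem_drop hx))
  have e₁ : (s.take (i + 2)).length = i + 2 := by simp; omega
  have h := TangleEquiv.interchange h₃ k₃
  have key : shift (i + 2) (BraidWord.toDiagram [(j - (i + 2), e')]) = [.cross j e'] := by
    simp [BraidWord.toDiagram, Piece.shift]; omega
  rw [e₁, h₁, key, List.take_append_drop] at h
  have k₄ := k₃.shift t₁
  rw [h₁, key] at k₄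
  have k₅ := h₃.suffix (s.drop (i + 2))
  rw [List.take_append_drop] at k₅
  have k₆ : Tan d (BraidWord.toDiagram [(i, e), (j, e')]) s (t₁ ++ t₂) := k₅.append k₄
  refine ⟨_, ?_, ?_, k₆, h.tan_iff.1 k₆, h⟩
  · rw [List.length_append, h₁, k₁]; omega
  · intro x hx
    exact (List.mem_append.1 hx).elim (h₂ x) (k₂ x)

/-! ### Identities in braid groups, certified by explicit rewriting. -/

/-- One rewriting step of a braid word: the first two letters cancel or commute, or the first three
are subject to the braid relation. -/
def rewriteHead : BraidWord → Option BraidWord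
  | (i, e) :: (j, e') :: w =>
    if i = j ∧ e' = !e then some w
    else if i + 2 ≤ j ∨ j + 2 ≤ i then some ((j, e') :: (i, e) :: w)
    else match e, e', w with
      | true, true, (k, true) :: w =>
        if i = k ∧ (j = i + 1 ∨ i = j + 1) then
          some ((j, true) :: (i, true) :: (j, true) :: w)
        else none
      | _, _, _ => none
  | _ => none

/-- Rewriting of a braid word on `n` strands. Each instruction consists of a position in the word
and of a generator that is inserted there together with its inverse, or `none`, which means that the
word is rewritten there. -/
def rewriteAll (n : ℕ) : List (ℕ × Option (ℕ × Bool)) → BraidWord → Option BraidWord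
  | [], w => some w
  | (k, none) :: l, w => (rewriteHead (w.drop k)).bind fun w' => rewriteAll n l (w.take k ++ w')
  | (k, some (i, e)) :: l, w =>
    if i + 1 < n then rewriteAll n l (w.take k ++ (i, e) :: (i, !e) :: w.drop k) else none

theorem of_rewriteHead (hw : ∀ x ∈ w, x.1 + 1 < n) (h : rewriteHead w = some w') :
    BraidEquiv d n w w' := by
  unfold rewriteHead at h
  split at h
  · rename_i i e j e' w
    have hi : i + 1 < n := hw (i, e) (by simp)
    have hj : j + 1 < n := hw (j, e') (by simp)
    split_ifs at h with h₁ h₂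
    · obtain ⟨rfl, rfl⟩ := h₁
      cases h
      exact (cancel e hi).append (refl fun x hx => hw x (by simp [hx]))
    · cases h
      refine append (w := [_, _]) (w' := [_, _]) ?_ (refl fun x hx => hw x (by simp [hx]))
      rcases h₂ with h₂ | h₂
      · exact far e e' h₂ hj
      · exact (far e' e h₂ hi).symm
    · split at h
      · rename_i k w
        split_ifs at h with h₃
        obtain ⟨rfl, h₃⟩ := h₃
        cases h
        refine append (w := [_, _, _]) (w' := [_, _, _]) ?_ (refl fun x hx => hw x (by simp [hx]))
        rcases h₃ with rfl | rfl
        · exact braid hj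
        · exact (braid hi).symm
      · cases h
  · cases h

theorem lt_of_rewriteHead (hw : ∀ x ∈ w, x.1 + 1 < n) (h : rewriteHead w = some w') :
    ∀ x ∈ w', x.1 + 1 < n := by
  unfold rewriteHead at h
  split at h
  · split_ifs at h
    · cases h
      exact fun x hx => hw x (by simp [hx])
    · cases h
      intro x hx
      simp only [List.mem_cons] at hx hw
      exact hw x (by tauto)
    · split at h
      · split_ifs at h
        cases h
        intro x hx
        simp only [List.mem_cons] at hx hw
        exact hw x (by tauto)
      · cases h
  · cases h

/-- Every instruction is a planar exchange or a second or third Reidemeister move, valid for all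
colors by transpositions. A braid identity is thus proved by evaluating `rewriteAll` on a list of
instructions. -/
theorem of_rewriteAll {l : List (ℕ × Option (ℕ × Bool))} (hw : ∀ x ∈ w, x.1 + 1 < n)
    (h : rewriteAll n l w = some w') : BraidEquiv d n w w' := by
  have split (k : ℕ) (w : BraidWord) : w = w.take k ++ w.drop k := (List.take_append_drop k w).symm
  have ht (k : ℕ) : ∀ x ∈ w.take k, x.1 + 1 < n := fun x hx => hw x (List.mem_of_mem_take hx)
  have hd (k : ℕ) : ∀ x ∈ w.drop k, x.1 + 1 < n := fun x hx => hw x (List.mem_of_mem_drop hx)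
  induction l generalizing w with
  | nil =>
    cases h
    exact refl hw
  | cons x l ih =>
    obtain ⟨k, _ | ⟨i, e⟩⟩ := x
    · simp only [rewriteAll, Option.bind_eq_some_iff] at h
      obtain ⟨v, hv, h⟩ := h
      have h₁ := (refl (d := d) (ht k)).append (of_rewriteHead (d := d) (hd k) hv)
      have h₂ : ∀ x ∈ w.take k ++ v, x.1 + 1 < n := fun x hx =>
        (List.mem_append.1 hx).elim (ht k x) (lt_of_rewriteHead (hd k) hv x)
      rw [← split k w] at h₁
      exact h₁.trans (ih h₂ h (fun j x hx => h₂ x (List.mem_of_mem_take hx))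
        fun j x hx => h₂ x (List.mem_of_mem_drop hx))
    · simp only [rewriteAll] at h
      split_ifs at h with hi
      have h₁ := (refl (d := d) (ht k)).append ((cancel (d := d) e hi).append (refl (hd k)))
      have h₂ : ∀ x ∈ w.take k ++ (i, e) :: (i, !e) :: w.drop k, x.1 + 1 < n := fun x hx => by
        simp only [List.mem_append, List.mem_cons] at hx
        rcases hx with hx | rfl | rfl | hx
        exacts [ht k x hx, hi, hi, hd k x hx]
      rw [List.nil_append, ← split k w] at h₁
      exact h₁.symm.trans (ih h₂ h (fun j x hx => h₂ x (List.mem_of_mem_take hx))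
        fun j x hx => h₂ x (List.mem_of_mem_drop hx))

theorem cancel_inv (hw : ∀ x ∈ w, x.1 + 1 < n) : BraidEquiv d n (w ++ w.inv) [] := by
  induction w with
  | nil => exact refl (by simp [BraidWord.inv])
  | cons x w ih =>
    have hx := hw x (by simp)
    have hw' : ∀ y ∈ w, y.1 + 1 < n := fun y hy => hw y (by simp [hy])
    have h := ((single x.2 hx).append (w := [x]) (ih hw')).append (single (d := d) (!x.2) hx)
    simpa [BraidWord.inv] using h.trans (cancel x.2 hx)

/-- Equivalent braid words give equivalent tangles. -/
theorem tangleEquiv (h : BraidEquiv d n w w') {s t : List Color} (hn : s.length = n)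
    (hs : ∀ x ∈ s, IsTransposition d x) (hw : Tan d w.toDiagram s t) :
    TangleEquiv d s t w.toDiagram w'.toDiagram := by
  obtain ⟨t', -, -, h₁, -, h₂⟩ := h s hn hs
  cases h₁.runs.det hw.runs
  exact h₂

end BraidEquiv

/-! ### Third Reidemeister moves with mixed signs, from the all-positive one. -/

namespace BraidEquiv

variable {d : ℕ}

theorem cross_over_pos : BraidEquiv d 3 [(0, true), (1, true), (0, true)]
    [(1, true), (0, true), (1, true)] := .of_rewriteAll (l := [(0, none)]) (by decide) rfl

theorem cross_over_neg : BraidEquiv d 3 [(0, true), (1, true), (0, false)]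
    [(1, false), (0, true), (1, true)] :=
  .of_rewriteAll (l := [(0, some (1, false)), (1, none), (3, none)]) (by decide) rfl

theorem cross_under_pos : BraidEquiv d 3 [(0, false), (1, false), (0, true)]
    [(1, true), (0, false), (1, false)] :=
  .of_rewriteAll (l := [(3, some (1, true)), (4, some (0, true)), (2, none), (1, none), (0, none)])
    (by decide) rfl

theorem cross_under_neg : BraidEquiv d 3 [(0, false), (1, false), (0, false)]
    [(1, false), (0, false), (1, false)] :=
  .of_rewriteAll (l := [(0, some (1, false)), (1, some (0, false)), (2, some (1, false)),
    (3, none), (5, none), (4, none), (3, none)]) (by decide) rfl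

end BraidEquiv

/-! ### A strand passing over or under a diagram -/

/-- The slice with the color of its maximum, if any, conjugated by `g`. -/
def Piece.recolor (g : Color) : Piece → Piece
  | .birth i c => .birth i (g * c * g⁻¹)
  | .death i => .death i
  | .cross i e => .cross i e

/-- The diagram with all colors conjugated by `g`. -/
def recolor (g : Color) (w : Diagram) : Diagram := w.map (Piece.recolor g)

@[simp] theorem recolor_nil (g : Color) : recolor g [] = [] := rfl

@[simp] theorem recolor_cons (g : Color) (X : Piece) (w : Diagram) :
    recolor g (X :: w) = X.recolor g :: recolor g w := rfl

@[simp] theorem recolor_append (g : Color) (u v : Diagram) :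
    recolor g (u ++ v) = recolor g u ++ recolor g v := List.map_append

@[simp] theorem recolor_one (w : Diagram) : recolor 1 w = w := by
  have h : Piece.recolor 1 = id := by funext X; cases X <;> simp [Piece.recolor]
  simp [recolor, h]

theorem recolor_shift (g : Color) (k : ℕ) (w : Diagram) :
    recolor g (shift k w) = shift k (recolor g w) := by
  simp only [recolor, shift, List.map_map]
  congr 1
  funext X
  cases X <;> rfl

theorem shift_zero (w : Diagram) : shift 0 w = w := by
  have h : Piece.shift 0 = id := by funext X; cases X <;> rfl
  simp [shift, h]

theorem recolor_recolor (g h : Color) (w : Diagram) :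
    recolor g (recolor h w) = recolor (g * h) w := by
  simp only [recolor, List.map_map]
  congr 1
  funext X
  cases X <;> simp [Piece.recolor, mul_assoc]

theorem recolor_toDiagram (g : Color) (w : BraidWord) : recolor g w.toDiagram = w.toDiagram := by
  simp [recolor, BraidWord.toDiagram, Piece.recolor]

/-- The strand in position `0` passes over (`true`) or under (`false`) the next `n` strands. -/
def sweep (e : Bool) : ℕ → Diagram
  | 0 => []
  | n + 1 => .cross 0 e :: shift 1 (sweep e n)

/-- The return of the passing strand along the path of `sweep`. -/
def sweepBack (e : Bool) : ℕ → Diagram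
  | 0 => []
  | n + 1 => shift 1 (sweepBack e n) ++ [.cross 0 !e]

def passedColor : Bool → Color → Color → Color
  | true, g, x => g * x * g⁻¹
  | false, _, x => x

def carriedColor : Bool → Color → Color → Color
  | true, g, _ => g
  | false, g, x => x * g * x⁻¹

/-- The colors of the other strands after a strand colored `g` has passed. -/
def passed (e : Bool) : Color → List Color → List Color
  | _, [] => []
  | g, x :: s => passedColor e g x :: passed e (carriedColor e g x) s

/-- The color of the strand colored `g` after it has passed. -/
def carried (e : Bool) : Color → List Color → Color
  | g, [] => g
  | g, x :: s => carried e (carriedColor e g x) s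

/-- The conjugation of a diagram over or under which a strand colored `g` passes. -/
def conjugator : Bool → Color → Color
  | true, g => g
  | false, _ => 1

section

variable {d : ℕ} {e : Bool} {g x : Color} {s t q : List Color} {w w' : Diagram}

@[simp] theorem length_passed : (passed e g s).length = s.length := by
  induction s generalizing g with
  | nil => rfl
  | cons x s ih => simp [passed, ih]

theorem passed_append : passed e g (s ++ q) = passed e g s ++ passed e (carried e g s) q := by
  induction s generalizing g with
  | nil => rfl
  | cons x s ih => simp [passed, carried, ih]

theorem carried_append : carried e g (s ++ q) = carried e (carried e g s) q := by
  induction s generalizing g with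
  | nil => rfl
  | cons x s ih => simp [carried, ih]

theorem sweep_add (m n : ℕ) : sweep e (m + n) = sweep e m ++ shift m (sweep e n) := by
  induction m with
  | zero => rw [zero_add, shift_zero]; rfl
  | succ m ih =>
    rw [Nat.add_right_comm]
    change Piece.cross 0 e :: shift 1 (sweep e (m + n)) = _
    rw [ih, shift_append, shift_shift]
    rfl

theorem isTransposition_carriedColor (hg : IsTransposition d g) (hx : IsTransposition d x) :
    IsTransposition d (carriedColor e g x) := by
  cases e
  exacts [hx.conj hg, hg]

theorem tan_cross : Tan d [.cross 0 e] [g, x] [passedColor e g x, carriedColor e g x] := by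
  cases e <;> exact ⟨by simp [passedColor, carriedColor], by simp⟩

theorem tan_sweep : Tan d (sweep e s.length) (g :: s) (passed e g s ++ [carried e g s]) := by
  induction s generalizing g with
  | nil => exact .nil _
  | cons x s ih =>
    exact (tan_cross.suffix s).append (u := [.cross 0 e]) (ih.shift [passedColor e g x])

theorem tan_sweepBack (hg : IsTransposition d g) (hs : ∀ x ∈ s, IsTransposition d x) :
    Tan d (sweepBack e s.length) (passed e g s ++ [carried e g s]) (g :: s) := by
  induction s generalizing g with
  | nil => exact .nil _
  | cons x s ih =>
    have hx := hs x (by simp)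
    refine ((ih (isTransposition_carriedColor hg hx) fun y hy => hs y (by simp [hy])).shift
      [passedColor e g x]).append (Tan.suffix (s := [_, _]) (t := [g, x]) ⟨?_, by simp⟩ s)
    have := hg.mul_self
    have := hx.mul_self
    cases e <;> simp [passedColor, carriedColor, mul_assoc, inv_of_mul_self, mul_self_mul, *]

/-- In `cut` this creates a detour behind a whole level, by which the sheet's strand returns to the
left. -/
theorem sweepBack_sweep (hg : IsTransposition d g) (hs : ∀ x ∈ s, IsTransposition d x) :
    TangleEquiv d (passed e g s ++ [carried e g s]) (passed e g s ++ [carried e g s])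
      (sweepBack e s.length ++ sweep e s.length) [] := by
  induction s generalizing g with
  | nil => exact .refl _
  | cons x s ih =>
    have hx := hs x (by simp)
    have hs' : ∀ y ∈ s, IsTransposition d y := fun y hy => hs y (by simp [hy])
    have hc := isTransposition_carriedColor (e := e) hg hx
    have h₁ := (ih hc hs').shift [passedColor e g x]
    have hp : passedColor e g x * passedColor e g x = 1 := by
      cases e
      exacts [hx.mul_self, conj_mul_self hx.mul_self]
    have h₂ := (TangleEquiv.cancel (d := d) hp hc.mul_self (!e)).suffix s
    have k₁ := (tan_sweepBack (e := e) hc hs').shift [passedColor e g x]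
    have k₂ := (tan_sweep (d := d) (e := e) (g := carriedColor e g x) (s := s)).shift
      [passedColor e g x]
    rw [Bool.not_not] at h₂
    have h₃ := h₂.ctx k₁ k₂
    exact .trans (by simpa [sweep, sweepBack, passed, carried] using h₃) (by simpa [passed, carried] using h₁)

/-- A strand can pass over or under the tangle diagram `w`. -/
structure Passable (d : ℕ) (e : Bool) (w : Diagram) (s t : List Color) : Prop where
  top : ∀ x ∈ s, IsTransposition d x
  tan : Tan d w s t
  tan_recolor : ∀ g, IsTransposition d g →
    Tan d (recolor (conjugator e g) w) (passed e g s) (passed e g t)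
  carried_eq : ∀ g, IsTransposition d g → carried e g s = carried e g t
  equiv : ∀ g, IsTransposition d g → TangleEquiv d (g :: s) (passed e g t ++ [carried e g t])
    (sweep e s.length ++ recolor (conjugator e g) w) (shift 1 w ++ sweep e t.length)

namespace Passable

theorem nil (hs : ∀ x ∈ s, IsTransposition d x) : Passable d e [] s s where
  top := hs
  tan := .nil _
  tan_recolor _ _ := .nil _
  carried_eq _ _ := rfl
  equiv _ _ := by simpa using TangleEquiv.refl _

theorem append {r : List Color} (h : Passable d e w s t) (h' : Passable d e w' t r) :
    Passable d e (w ++ w') s r where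
  top := h.top
  tan := h.tan.append h'.tan
  tan_recolor g hg := by
    rw [recolor_append]
    exact (h.tan_recolor g hg).append (h'.tan_recolor g hg)
  carried_eq g hg := (h.carried_eq g hg).trans (h'.carried_eq g hg)
  equiv g hg := by
    have h₁ := (h.equiv g hg).right ((h'.tan_recolor g hg).suffix [carried e g t])
    have h₂ := (h'.equiv g hg).left (h.tan.shift [g])
    rw [← h'.carried_eq g hg] at h₂ ⊢
    simpa using h₁.trans (by simpa using h₂)

theorem suffix (h : Passable d e w s t) (hq : ∀ x ∈ q, IsTransposition d x) :
    Passable d e w (s ++ q) (t ++ q) where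
  top x hx := (List.mem_append.1 hx).elim (h.top x) (hq x)
  tan := h.tan.suffix q
  tan_recolor g hg := by
    rw [passed_append, passed_append, h.carried_eq g hg]
    exact (h.tan_recolor g hg).suffix _
  carried_eq g hg := by rw [carried_append, carried_append, h.carried_eq g hg]
  equiv g hg := by
    have k := tan_sweep (d := d) (e := e) (g := carried e g t) (s := q)
    have h₁ := TangleEquiv.interchange (h.tan_recolor g hg) k
    have h₂ := tan_sweep (d := d) (e := e) (g := g) (s := s)
    have h₃ := h₁.symm.left (u := sweep e s.length) (s := g :: (s ++ q)) (by
      have := h₂.suffix q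
      rw [h.carried_eq g hg] at this
      simpa using this)
    have h₄ := ((h.equiv g hg).suffix q).right (v := shift t.length (sweep e q.length))
      (t := passed e g t ++ (passed e (carried e g t) q ++ [carried e (carried e g t) q])) (by
      have := k.shift (passed e g t)
      simpa using this)
    rw [List.length_append, List.length_append, sweep_add, sweep_add, passed_append, carried_append]
    simp only [length_passed, List.append_assoc, List.cons_append] at h₃ h₄ ⊢
    exact h₃.trans h₄

theorem shift (h : Passable d e w s t) (hx : IsTransposition d x) :
    Passable d e (shift 1 w) (x :: s) (x :: t) where
  top y hy := (List.mem_cons.1 hy).elim (· ▸ hx) (h.top y)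
  tan := h.tan.shift [x]
  tan_recolor g hg := by
    have := (h.tan_recolor _ (isTransposition_carriedColor (e := e) hg hx)).shift
      [passedColor e g x]
    rw [recolor_shift]
    cases e
    exacts [this, this]
  carried_eq g hg := h.carried_eq _ (isTransposition_carriedColor hg hx)
  equiv g hg := by
    have h₁ := ((h.equiv _ (isTransposition_carriedColor (e := e) hg hx)).shift
      [passedColor e g x]).left (u := [.cross 0 e]) (tan_cross.suffix s)
    have h₂ := (TangleEquiv.interchange (tan_cross (d := d) (e := e) (g := g) (x := x))
      h.tan).right (v := _root_.shift 1 (sweep e t.length))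
      ((tan_sweep (d := d) (e := e) (g := carriedColor e g x) (s := t)).shift [passedColor e g x])
    -- An over-strand keeps its color, and an under-strand recolors nothing whatever its color, so
    -- passing `x` does not affect the conjugator.
    have hc : conjugator e (carriedColor e g x) = conjugator e g := by cases e <;> rfl
    rw [hc] at h₁
    simp only [shift_append, shift_shift, List.append_assoc] at h₁ h₂ ⊢
    rw [recolor_shift]
    exact h₁.trans h₂

end Passable

end

/-! ### Single slices can be passed. -/

namespace Passable

variable {d : ℕ} {a b c : Color}

/-- A slide across the maximum accounts for one of the two crossings; the other comes from a
cancelling pair created first. -/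
theorem birth_zero (e : Bool) (hc : IsTransposition d c) :
    Passable d e [.birth 0 c] [] [c, c] where
  top := by simp
  tan := ⟨by simp, by simpa⟩
  tan_recolor g hg := by
    cases e
    · exact ⟨by simp [Piece.recolor, passed, passedColor, conjugator],
        by simpa [Piece.recolor, conjugator] using hc⟩
    · exact ⟨by simp [Piece.recolor, passed, passedColor, carriedColor, conjugator],
        by simpa [Piece.recolor, conjugator] using hg.conj hc⟩
  carried_eq g hg := by
    cases e <;> simp [carried, carriedColor, mul_assoc, inv_of_mul_self, mul_self_mul, hc.mul_self]
  equiv g hg := by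
    have h₁ := hc.mul_self
    have h₂ := hg.mul_self
    have hk := hg.conj hc
    cases e
    · have s₁ := (TangleEquiv.slideBirth_over (x := g) hc).right (v := [.cross 1 false])
        (t := [c, c, g]) ⟨by simp [mul_assoc, inv_of_mul_self, mul_self_mul, h₁], by simp⟩
      have s₂ := (TangleEquiv.cancel (d := d) h₁ h₂ true).inside [c] [] (u := [.birth 0 c])
        (v := []) (s := [g]) (t := [c, c, g]) ⟨by simp, by simpa⟩ ⟨by simp, by simp⟩
      have s₃ := s₂.symm.trans s₁
      simpa [passed, carried, passedColor, carriedColor, conjugator, sweep, Piece.shift, mul_assoc,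
        inv_of_mul_self, mul_self_mul, h₁, Piece.recolor] using s₃
    · have s₁ := (TangleEquiv.slideBirth_under hg hk).right (v := [.cross 1 true])
        (t := [g * c * g⁻¹, g * c * g⁻¹, g])
        ⟨by simp [mul_assoc, inv_of_mul_self, mul_self_mul, h₂], by simp⟩
      have s₂ := (TangleEquiv.cancel (d := d) hk.mul_self h₂ false).inside [g * c * g⁻¹] []
        (u := [.birth 0 (g * c * g⁻¹)]) (v := []) (s := [g]) (t := [g * c * g⁻¹, g * c * g⁻¹, g])
        ⟨by simp, by simpa⟩ ⟨by simp, by simp⟩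
      have s₃ := s₂.symm.trans s₁
      have e₁ : g * (g * c * g⁻¹) * g⁻¹ = c := by
        simp [mul_assoc, inv_of_mul_self, mul_self_mul, h₂]
      rw [e₁] at s₃
      simpa [passed, carried, passedColor, carriedColor, conjugator, sweep, Piece.shift,
        Piece.recolor] using s₃

theorem death_zero (e : Bool) (hc : IsTransposition d c) :
    Passable d e [.death 0] [c, c] [] where
  top := by simpa
  tan := ⟨by simp, by simp⟩
  tan_recolor g hg := by
    cases e <;>
      exact ⟨by simp [Piece.recolor, passed, passedColor, carriedColor], by simp [Piece.recolor]⟩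
  carried_eq g hg := by
    cases e <;> simp [carried, carriedColor, mul_assoc, inv_of_mul_self, mul_self_mul, hc.mul_self]
  equiv g hg := by
    have h₁ := hc.mul_self
    have h₂ := hg.mul_self
    cases e
    · have s₁ := (TangleEquiv.slideDeath_neg (d := d) (c * g * c⁻¹) c).left (s := [g, c, c])
        (u := [.cross 0 false]) ⟨by simp, by simp⟩
      have e₁ : c * (c * g * c⁻¹) * c⁻¹ = g := by
        simp [mul_assoc, inv_of_mul_self, mul_self_mul, h₁]
      rw [e₁] at s₁
      have s₂ := (TangleEquiv.cancel (d := d) h₂ h₁ false).inside [] [c] (u := [])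
        (v := [.death 1]) (s := [g, c, c]) (t := [g]) ⟨by simp, by simp⟩ ⟨by simp, by simp⟩
      have s₃ := s₁.trans s₂
      simpa [passed, carried, passedColor, carriedColor, conjugator, sweep, Piece.shift,
        Piece.recolor] using s₃
    · have s₁ := (TangleEquiv.slideDeath_pos (d := d) (c := c) h₂).left (s := [g, c, c])
        (u := [.cross 0 true]) ⟨by simp, by simp⟩
      have s₂ := (TangleEquiv.cancel (d := d) h₂ h₁ true).inside [] [c] (u := [])
        (v := [.death 1]) (s := [g, c, c]) (t := [g]) ⟨by simp, by simp⟩ ⟨by simp, by simp⟩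
      have s₃ := s₁.trans s₂
      simpa [passed, carried, passedColor, carriedColor, conjugator, sweep, Piece.shift,
        Piece.recolor] using s₃

/-- The sign of the crossing and the choice of over or under give four third Reidemeister moves. -/
theorem cross_zero (e e' : Bool) (ha : IsTransposition d a) (hb : IsTransposition d b) {s : List Color}
    (h : Tan d [.cross 0 e'] [a, b] s) : Passable d e [.cross 0 e'] [a, b] s := by
  have h₁ := ha.mul_self
  have h₂ := hb.mul_self
  have key (g : Color) (hg : IsTransposition d g) : Tan d [.cross 0 e'] (passed e g [a, b]) (passed e g s) ∧
      carried e g [a, b] = carried e g s := by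
    have h₃ := hg.mul_self
    have h₄ := h.runs
    cases e' <;> simp only [runs_cons, acts_pos_zero, acts_neg_zero, runs_nil, exists_eq_left'] at h₄ <;>
      subst h₄ <;> cases e <;> refine ⟨⟨?_, by simp⟩, ?_⟩ <;>
      simp [passed, carried, passedColor, carriedColor, mul_assoc, inv_of_mul_self, mul_self_mul, h₁, h₂, h₃]
  refine ⟨by simp [ha, hb], h, fun g hg => by simpa [Piece.recolor] using (key g hg).1,
    fun g hg => (key g hg).2, fun g hg => ?_⟩
  have hs : s.length = 2 := by
    have h₄ := h.runs
    cases e' <;> simp only [runs_cons, acts_pos_zero, acts_neg_zero, runs_nil, exists_eq_left'] at h₄ <;>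
      subst h₄ <;> rfl
  have k := (tan_sweep (d := d) (e := e) (g := g) (s := [a, b])).append ((key g hg).1.suffix [carried e g [a, b]])
  rw [(key g hg).2] at k
  have h' : ∀ x ∈ [g, a, b], IsTransposition d x := by simp [hg, ha, hb]
  rw [hs]
  cases e <;> cases e'
  · exact BraidEquiv.cross_under_neg.tangleEquiv rfl h' k
  · exact BraidEquiv.cross_under_pos.tangleEquiv rfl h' k
  · exact BraidEquiv.cross_over_neg.tangleEquiv rfl h' k
  · exact BraidEquiv.cross_over_pos.tangleEquiv rfl h' k

end Passable

theorem Piece.Acts.passable {d : ℕ} {X : Piece} {s t : List Color} (e : Bool) (h : X.Acts s t)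
    (hX : Good d [X]) (hs : ∀ x ∈ s, IsTransposition d x) :
    Passable d e [X] s t ∧ ∀ x ∈ t, IsTransposition d x := by
  have base {X₀ : Piece} {s₀ t₀ : List Color} (p q : List Color) (h₀ : Passable d e [X₀] s₀ t₀)
      (ht₀ : ∀ x ∈ t₀, IsTransposition d x) (hp : ∀ x ∈ p, IsTransposition d x)
      (hq : ∀ x ∈ q, IsTransposition d x) : Passable d e (_root_.shift p.length [X₀])
        (p ++ (s₀ ++ q)) (p ++ (t₀ ++ q)) ∧ ∀ x ∈ p ++ (t₀ ++ q), IsTransposition d x := by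
    constructor
    · induction p with
      | nil => simpa only [List.length_nil, shift_zero, List.nil_append] using h₀.suffix hq
      | cons x p ih =>
        have := (ih fun y hy => hp y (by simp [hy])).shift (hp x (by simp))
        rwa [shift_shift] at this
    · simp only [List.mem_append]
      rintro x (hx | hx | hx)
      exacts [hp x hx, ht₀ x hx, hq x hx]
  cases h with
  | birth p q c =>
    simp only [List.mem_append] at hs
    have hc : IsTransposition d c := by simpa using hX
    simpa [Piece.shift] using base p q (.birth_zero e hc) (by simpa)
      (fun x hx => hs x (.inl hx)) (fun x hx => hs x (.inr hx))
  | death p q c =>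
    simp only [List.mem_append, List.mem_cons] at hs
    have hc : IsTransposition d c := hs c (by simp)
    simpa [Piece.shift] using base p q (.death_zero e hc) (by simp)
      (fun x hx => hs x (.inl hx)) (fun x hx => hs x (by simp [hx]))
  | pos p q a b =>
    simp only [List.mem_append, List.mem_cons] at hs
    have ha : IsTransposition d a := hs a (by simp)
    have hb : IsTransposition d b := hs b (by simp)
    simpa [Piece.shift] using base (t₀ := [a * b * a⁻¹, a]) p q (.cross_zero e true ha hb ⟨by simp, by simp⟩)
      (by simp [ha, ha.conj hb]) (fun x hx => hs x (.inl hx)) (fun x hx => hs x (by simp [hx]))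
  | neg p q a b =>
    simp only [List.mem_append, List.mem_cons] at hs
    have ha : IsTransposition d a := hs a (by simp)
    have hb : IsTransposition d b := hs b (by simp)
    simpa [Piece.shift] using base (t₀ := [b, b * a * b⁻¹]) p q (.cross_zero e false ha hb ⟨by simp, by simp⟩)
      (by simp [hb, hb.conj ha]) (fun x hx => hs x (.inl hx)) (fun x hx => hs x (by simp [hx]))

theorem Tan.passable {d : ℕ} {w : Diagram} {s t : List Color} (e : Bool) (h : Tan d w s t)
    (hs : ∀ x ∈ s, IsTransposition d x) :
    Passable d e w s t ∧ ∀ x ∈ t, IsTransposition d x := by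
  induction w generalizing s with
  | nil =>
    cases runs_nil.1 h.runs
    exact ⟨.nil hs, hs⟩
  | cons X w ih =>
    obtain ⟨r, hX, hw⟩ := (tan_append (u := [X])).1 h
    obtain ⟨r', h₁, h₂⟩ := runs_cons.1 hX.runs
    cases runs_nil.1 h₂
    obtain ⟨k₁, k₂⟩ := h₁.passable e hX.good hs
    obtain ⟨k₃, k₄⟩ := ih hw k₂
    exact ⟨k₁.append k₃, k₄⟩

/-! ### Cutting a pair of strands with a trivial sheet -/

/-- The two colors are transpositions of disjoint pairs of labels. -/
def DisjointLabels (a x : Color) : Prop :=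
  ∃ i j k l : ℕ, i ≠ j ∧ i ≠ k ∧ i ≠ l ∧ j ≠ k ∧ j ≠ l ∧ k ≠ l ∧ a = swap i j ∧ x = swap k l

theorem DisjointLabels.symm {a x : Color} (h : DisjointLabels a x) : DisjointLabels x a := by
  obtain ⟨i, j, k, l, h₁, h₂, h₃, h₄, h₅, h₆, rfl, rfl⟩ := h
  exact ⟨k, l, i, j, h₆, h₂.symm, h₄.symm, h₃.symm, h₅.symm, h₁, rfl, rfl⟩

theorem DisjointLabels.conj {a x : Color} (h : DisjointLabels a x) : a * x * a⁻¹ = x := by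
  obtain ⟨i, j, k, l, h₁, h₂, h₃, h₄, h₅, h₆, rfl, rfl⟩ := h
  rw [← swap_apply_apply, swap_apply_of_ne_of_ne h₂.symm h₄.symm,
    swap_apply_of_ne_of_ne h₃.symm h₅.symm]

theorem DisjointLabels.equiv {d : ℕ} {a x : Color} (h : DisjointLabels a x) :
    TangleEquiv d [a, x] [a, x] [.cross 0 true, .cross 0 true] [] := by
  refine .of_move ⟨?_, by simp⟩ (.nil _) (.inr (.inr ?_))
  · simp [h.conj, h.symm.conj]
  · obtain ⟨i, j, k, l, h₁, h₂, h₃, h₄, h₅, h₆, rfl, rfl⟩ := h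
    exact MoveN.mk [] [] i j k l h₁ h₂ h₃ h₄ h₅ h₆

section

variable {d : ℕ} {a b c : Color} {s : List Color}

theorem passed_of_disjoint (e : Bool) (hs : ∀ x ∈ s, DisjointLabels a x) :
    passed e a s = s ∧ carried e a s = a := by
  induction s with
  | nil => exact ⟨rfl, rfl⟩
  | cons x s ih =>
    have hx := hs x (by simp)
    obtain ⟨h₁, h₂⟩ := ih fun y hy => hs y (by simp [hy])
    cases e <;> simp [passed, carried, passedColor, carriedColor, hx.conj, hx.symm.conj, h₁, h₂]

theorem passed_false (g : Color) (s : List Color) : passed false g s = s := by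
  induction s generalizing g with
  | nil => rfl
  | cons x s ih => simp [passed, passedColor, ih]

/-- Going out in front and coming back behind, the strand meets each other strand in two crossings
of the same sign. The clasp with the farthest strand is innermost and comes off first by move N,
then the next one. -/
theorem sweep_sweepBack_of_disjoint (hs : ∀ x ∈ s, DisjointLabels a x) :
    TangleEquiv d (a :: s) (a :: s) (sweep true s.length ++ sweepBack false s.length) [] := by
  induction s with
  | nil => exact .refl _
  | cons x s ih =>
    have hx := hs x (by simp)
    have h₁ : Tan d [.cross 0 true] [a, x] [x, a] := ⟨by simp [hx.conj], by simp⟩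
    have h₂ : Tan d [.cross 0 true] [x, a] [a, x] := ⟨by simp [hx.symm.conj], by simp⟩
    have h₃ := ((ih fun y hy => hs y (by simp [hy])).shift [x]).ctx (h₁.suffix s) (h₂.suffix s)
    exact .trans (by simpa [sweep, sweepBack] using h₃) (hx.equiv.suffix s)

/-- An unknot around all strands at a level, in front of them and then behind them. -/
theorem ring_all (h : Dihedral d a b c) (hs : ∀ x ∈ s, DisjointLabels a x) :
    TangleEquiv d (b :: b :: s) (c :: c :: s)
      ([.birth 0 a] ++ (shift 1 (sweep true (s.length + 2) ++ sweepBack false (s.length + 2)) ++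
        [.death 0])) [.death 0, .birth 0 c] := by
  have h₁ := h.conj
  have h₃ := h.rotate.conj
  have h₅ := h.rotate.flip.conj
  have h₆ := h.rotate.rotate.conj
  -- Past the two strands colored `b`, now `c`, the ring strand is again colored `a`, so it first
  -- comes off all of `s`; the ring around two strands remains.
  have k := (sweep_sweepBack_of_disjoint (d := d) hs).inside [a, c, c] [] (s := b :: b :: s)
    (t := c :: c :: s) (u := [.birth 0 a, .cross 1 true, .cross 2 true])
    (v := [.cross 2 true, .cross 1 true, .death 0])
    ⟨by simp [*], by simpa using h.left⟩ ⟨by simp [*], by simp⟩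
  refine .trans ?_ ((TangleEquiv.ring h).suffix s)
  simpa [sweep, sweepBack, shift_shift, Piece.shift] using k

/-- A pair of strands colored `(p q)` is cut with the help of an unknot colored `(p p')`. -/
theorem cut (h : Dihedral d a b c) (hs : ∀ x ∈ s, DisjointLabels a x)
    (hs' : ∀ x ∈ s, IsTransposition d x) {T B : Diagram} (hT : Tan d T [] (b :: b :: s))
    (hB : Tan d B (b :: b :: s) []) :
    TangleEquiv d [] [] (T ++ (B ++ [.birth 0 a, .death 0]))
        (T ++ ([.death 0, .birth 0 c] ++ recolor a B)) ∧
      Tan d (recolor a B) (c :: c :: s) [] := by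
  have hlev : ∀ x ∈ b :: b :: s, IsTransposition d x := by
    simpa using ⟨h.mid, hs'⟩
  have hlev' : ∀ x ∈ c :: c :: s, IsTransposition d x := by
    simpa using ⟨h.right, hs'⟩
  have hbirth : Tan d [.birth 0 a] [] [a, a] := ⟨by simp, by simpa using h.left⟩
  have hdeath : Tan d [.death 0] [a, a] [] := ⟨by simp, by simp⟩
  have p₁ : passed true a (b :: b :: s) = c :: c :: s := by
    simp [passed, passedColor, carriedColor, h.conj, (passed_of_disjoint true hs).1]
  have p₂ : carried true a (b :: b :: s) = a := by
    simp [carried, carriedColor, (passed_of_disjoint true hs).2]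
  have p₃ : carried false a (c :: c :: s) = a := by
    simp [carried, carriedColor, h.rotate.rotate.conj, h.rotate.flip.conj,
      (passed_of_disjoint false hs).2]
  have above := (hB.passable true hlev).1
  have hB' : Tan d (recolor a B) (c :: c :: s) [] := p₁ ▸ above.tan_recolor a h.left
  have below := (hB'.passable false hlev').1
  refine ⟨.left hT ?_, hB'⟩
  have e₀ := TangleEquiv.interchange (hbirth.append hdeath) hB
  have e₁ := (TangleEquiv.interchange hdeath hB).left (hbirth.suffix (b :: b :: s))
  have e₂ := (above.equiv a h.left).symm
  have e₃ := sweepBack_sweep (e := false) h.left hlev'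
  have t₁ := tan_sweep (d := d) (e := true) (g := a) (s := b :: b :: s)
  have t₂ := tan_sweepBack (e := false) h.left hlev'
  have e₄ := below.equiv a h.left
  have c₀ (e : Bool) : carried e a [] = a := rfl
  have c₁ (e : Bool) : passed e a [] = [] := rfl
  have c₂ (e : Bool) : sweep e 0 = [] := rfl
  simp only [p₁, p₂, p₃, passed_false, conjugator, recolor_one, c₀, c₁, c₂, List.length_nil,
    List.append_nil, List.nil_append, shift_zero, List.length_cons] at e₀ e₁ e₂ e₃ e₄ t₁ t₂
  have e₅ := e₃.symm.ctx t₁ (hB'.suffix [a])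
  have e₆ := e₄.left (t₁.append t₂)
  -- The right-hand strand of the unknot starts on the left of `B`. It goes to the right in front of
  -- `B` (`e₂`), a detour behind the level is inserted (`e₅`), and its second half carries the
  -- strand back behind the recolored `B` (`e₆`). What remains is a loop around the level.
  have e₇ : TangleEquiv d (a :: b :: b :: s) [a] (shift 1 B)
      (sweep true (s.length + 2) ++ sweepBack false (s.length + 2) ++ shift 1 (recolor a B)) :=
    e₂.trans <| e₅.trans <| by simpa using e₆
  have e₈ := (e₇.shift [a]).ctx (hbirth.suffix (b :: b :: s)) hdeath
  have e₉ := (TangleEquiv.interchange hdeath hB').symm.left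
    ((hbirth.suffix (b :: b :: s)).append ((t₁.append t₂).shift [a]))
  have e₁₀ := (ring_all h hs).right hB'
  simp only [List.length_nil, shift_zero, List.length_cons, shift_append, shift_shift,
    List.append_assoc, List.cons_append, List.nil_append] at e₀ e₁ e₈ e₉ e₁₀ ⊢
  exact e₀.symm.trans <| e₁.trans <| e₈.trans <| e₉.trans e₁₀

end

/-! ### Maxima passing other pairs of strands -/

/-- The pair of strands `0, 1` crosses over the pair of strands `2, 3`. -/
def pairCross : BraidWord := [(1, true), (0, true), (2, true), (1, true)]

/-- A braid word moved to the right by `k` strands. -/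
def BraidWord.shift (k : ℕ) (w : BraidWord) : BraidWord := w.map fun x => (x.1 + k, x.2)

theorem BraidWord.toDiagram_shift (k : ℕ) (w : BraidWord) :
    (w.shift k).toDiagram = _root_.shift k w.toDiagram := by
  simp [BraidWord.shift, BraidWord.toDiagram, _root_.shift, Piece.shift]

theorem BraidWord.inv_shift (k : ℕ) (w : BraidWord) : (w.shift k).inv = w.inv.shift k := by
  simp [BraidWord.shift, BraidWord.inv]

theorem BraidWord.shift_append (k : ℕ) (u w : BraidWord) :
    BraidWord.shift k (u ++ w) = u.shift k ++ w.shift k := by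
  simp [BraidWord.shift]

namespace TangleEquiv

variable {d : ℕ} {c x y : Color} {s : List Color}

theorem cap_over_strand (hc : IsTransposition d c) (hx : IsTransposition d x) :
    TangleEquiv d [x] [x, c, c] [.birth 0 c, .cross 1 true, .cross 0 true] [.birth 1 c] := by
  have h₁ := hc.mul_self
  have e₁ := (Passable.birth_zero false hc).equiv x hx
  have e₂ : c * (c * x * c⁻¹) * c⁻¹ = x := by simp [mul_assoc, inv_of_mul_self, mul_self_mul, h₁]
  simp only [passed_false, carried, carriedColor, e₂, conjugator, recolor_one] at e₁
  have k : Tan d [.cross 1 true, .cross 0 true] [c, c, x] [x, c, c] :=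
    ⟨by simp [mul_assoc, inv_of_mul_self, mul_self_mul, h₁], by simp⟩
  have e₃ := e₁.right k
  have k₁ : BraidEquiv d 3 [(0, false), (1, false), (1, true), (0, true)] [] :=
    .of_rewriteAll (l := [(1, none), (0, none)]) (by decide) rfl
  obtain ⟨t, -, -, -, k₂, k₃⟩ := k₁ [x, c, c] rfl (by simp [hc, hx])
  cases runs_nil.1 k₂.runs
  exact e₃.trans (k₃.left (u := [.birth 1 c]) (s := [x]) ⟨by simp, by simpa⟩)

theorem cap_under_strand (hc : IsTransposition d c) (hx : IsTransposition d x) :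
    TangleEquiv d [x] [x * c * x⁻¹, x * c * x⁻¹, x]
      [.birth 1 c, .cross 0 true, .cross 1 true] [.birth 0 (x * c * x⁻¹)] :=
  ((Passable.birth_zero true hc).equiv x hx).symm

theorem cap_over_pair (hc : IsTransposition d c) (hx : IsTransposition d x)
    (hy : IsTransposition d y) :
    TangleEquiv d [x, y] [x, y, c, c] (.birth 0 c :: pairCross.toDiagram) [.birth 2 c] := by
  have h₁ := hc.mul_self
  have h₂ := (cap_over_strand hc hx).inside [] [y] (u := []) (v := [.cross 2 true, .cross 1 true])
    (s := [x, y]) (t := [x, y, c, c]) (.nil _)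
    ⟨by simp [mul_assoc, inv_of_mul_self, mul_self_mul, h₁], by simp⟩
  exact h₂.trans ((cap_over_strand hc hy).shift [x])

/-- The maximum passes behind two strands of equal color; the two conjugations cancel and it regains
the color `c`. For `cap_over_pair` the two strands may have different colors. -/
theorem cap_under_pair (hc : IsTransposition d c) (hx : IsTransposition d x) :
    TangleEquiv d [x, x] [c, c, x, x] (.birth 2 c :: pairCross.toDiagram) [.birth 0 c] := by
  have h₁ := hx.mul_self
  have k : BraidEquiv d 4 pairCross [(1, true), (2, true), (0, true), (1, true)] :=
    .of_rewriteAll (l := [(1, none)]) (by decide) rfl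
  have hk := hx.conj hc
  have e₂ : x * (x * c * x⁻¹) * x⁻¹ = c := by simp [mul_assoc, inv_of_mul_self, mul_self_mul, h₁]
  have h₀ := (k.tangleEquiv (t := [c, c, x, x]) rfl (s := [x, x, c, c]) (by simp [hx, hc])
    ⟨by simp [BraidWord.toDiagram, pairCross, mul_assoc, inv_of_mul_self, mul_self_mul, h₁], by
      simp [BraidWord.toDiagram, pairCross]⟩).left (u := [.birth 2 c]) (s := [x, x])
    ⟨by simp, by simpa⟩
  have h₂ := (cap_under_strand hc hx).inside [x] [] (u := []) (v := [.cross 0 true, .cross 1 true])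
    (s := [x, x]) (t := [c, c, x, x]) (.nil _)
    ⟨by simp [mul_assoc, inv_of_mul_self, mul_self_mul, h₁], by simp⟩
  have h₃ := (cap_under_strand hk hx).suffix [x]
  rw [e₂] at h₃
  exact h₀.trans <| h₂.trans h₃

theorem cap_pairFullTwist (hc : IsTransposition d c) (hx : IsTransposition d x) :
    TangleEquiv d [x, x] [c, c, x, x] (.birth 0 c :: (pairFullTwist 0).toDiagram) [.birth 0 c] := by
  have h₁ := hx.mul_self
  have h := (cap_over_pair hc hx hx).right (v := pairCross.toDiagram) (t := [c, c, x, x])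
    ⟨by simp [BraidWord.toDiagram, pairCross, mul_assoc, inv_of_mul_self, mul_self_mul, h₁], by
      simp [BraidWord.toDiagram, pairCross]⟩
  exact h.trans (cap_under_pair hc hx)

end TangleEquiv

/-! ### The braid of move IV -/

/-- The strand `1` makes a full twist around the strands `2, …, 5`. -/
def strandFullTwist : BraidWord :=
  [(1, true), (2, true), (3, true), (4, true), (4, true), (3, true), (2, true), (1, true)]

/-- The pair of strands `0, 1` makes a full twist around the strands `2, …, 5` and in itself. -/
def pairFullTwistTwo : BraidWord :=
  pairCross ++ pairCross.shift 2 ++ pairCross.shift 2 ++ pairCross ++ [(0, true), (0, true)]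

/-- Let `X` be `pairCross`, `F` be `strandFullTwist` and `P` be `pairFullTwistTwo`. Since `x₂ X = X
x₀`, the braid of move IV is `X P X⁻¹`, and `P = F x₀ F x₀`: one strand of the pair encircles the
four others, then its partner encircles it together with them. The grouping shows the level after `X
F` at which the pair will be cut. -/
theorem braidIV_equiv (d : ℕ) : BraidEquiv d 6 (braidIV 3) (pairCross ++ strandFullTwist ++
    (((0, true) :: (strandFullTwist ++ [(0, true)])) ++ pairCross.inv)) :=
  .symm (.of_rewriteAll (l := [11, 10, 9, 8, 7, 6, 5, 13, 11, 10, 9, 8, 7, 14, 13, 11, 10, 9, 15,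
    14, 13, 11, 16, 15, 14, 12, 17, 16, 14, 13, 18, 16, 18, 17, 17, 18, 16, 19, 17, 19, 21, 20, 19,
    18].map (·, none)) (by decide) rfl)

/-- This is `P = F x₀ F x₀` again, solved for `x₀ F x₀` so that every factor on the left except
`F⁻¹` is absorbed by a maximum. -/
theorem strandFullTwist_equiv (d : ℕ) : BraidEquiv d 6
    ((0, true) :: (pairFullTwistTwo ++ (0, false) :: strandFullTwist.inv))
    ((0, true) :: (strandFullTwist ++ [(0, true)])) :=
  .of_rewriteAll (l := [2, 4, 3, 6, 5, 4, 10, 14, 15, 13, 11, 9, 8, 7, 6, 5, 11, 10, 8, 7, 6, 13,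
    12, 11, 10, 8, 7, 15, 14, 13, 12, 11, 10, 8, 18, 17, 16, 15, 14, 13, 12, 11, 10].map (·, none))
    (by decide) rfl

theorem tan_inv {d n : ℕ} {w : BraidWord} {s t : List Color} (hw : ∀ x ∈ w, x.1 + 1 < n)
    (hn : s.length = n) (hs : ∀ x ∈ s, IsTransposition d x) (h : Tan d w.toDiagram s t) :
    Tan d w.inv.toDiagram t s := by
  obtain ⟨r, -, -, h₁, h₂, -⟩ := BraidEquiv.cancel_inv (d := d) hw s hn hs
  cases runs_nil.1 h₂.runs
  rw [BraidWord.toDiagram_append] at h₁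
  exact (h₁.split h.runs).2

namespace TangleEquiv

variable {d : ℕ} {c y z : Color}

theorem cap_pairFullTwistTwo (hc : IsTransposition d c) (hy : IsTransposition d y) :
    TangleEquiv d [y, y, y, y] [c, c, y, y, y, y] (.birth 0 c :: pairFullTwistTwo.toDiagram)
      [.birth 0 c] := by
  have h₁ := hy.mul_self
  have h₂ := hc.mul_self
  have twist (e : Bool) := (twistBirth hc e).suffix [y, y, y, y]
  have k₁ : Tan d pairCross.toDiagram [y, y, c, c] [c, c, y, y] :=
    ⟨by simp [BraidWord.toDiagram, pairCross, mul_assoc, inv_of_mul_self, mul_self_mul, h₁], by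
      simp [BraidWord.toDiagram, pairCross]⟩
  have k₂ : Tan d pairCross.toDiagram [c, c, y, y] [y, y, c, c] :=
    ⟨by simp [BraidWord.toDiagram, pairCross, mul_assoc, inv_of_mul_self, mul_self_mul, h₂], by
      simp [BraidWord.toDiagram, pairCross]⟩
  have k₃ : Tan d [.cross 0 true] [c, c] [c, c] := ⟨by simp, by simp⟩
  have k₄ := (k₃.append k₃).suffix [y, y, y, y]
  have k₅ := (k₁.suffix [y, y]).append k₄
  have k₆ := (k₁.shift [y, y]).append k₅
  have k₇ := (k₂.shift [y, y]).append k₆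
  have s₁ := ((cap_over_pair hc hy hy).suffix [y, y]).right k₇
  have s₂ := ((cap_over_pair hc hy hy).shift [y, y]).right k₆
  have s₃ := ((cap_under_pair hc hy).shift [y, y]).right k₅
  have s₄ := ((cap_under_pair hc hy).suffix [y, y]).right k₄
  have s₅ := (twist true).right (k₃.suffix [y, y, y, y])
  exact s₁.trans <| s₂.trans <| s₃.trans <| s₄.trans <| s₅.trans <| twist true

/-- The maximum creates `x₀`, `P` and `x₀⁻¹` for free above `F⁻¹`, and `strandFullTwist_equiv`
identifies the product with `x₀ F x₀`. -/
theorem cap_strandFullTwist (h : Dihedral d c y z) :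
    TangleEquiv d [y, y, y, y] [c, c, z, z, z, z] (.birth 0 c :: strandFullTwist.inv.toDiagram)
      (.birth 0 c :: BraidWord.toDiagram ((0, true) :: (strandFullTwist ++ [(0, true)]))) := by
  have hc := h.left
  have hy := h.mid
  have hz := h.right
  have h₁ := h.conj
  have h₂ := h.rotate.rotate.conj
  have h₃ := h.rotate.conj
  have h₄ := h.flip.conj
  have h₅ := h.rotate.flip.conj
  have h₆ := h.rotate.rotate.flip.conj
  have hlev : ∀ x ∈ [c, c, y, y, y, y], IsTransposition d x := by simp [hc, hy]
  have hlev' : ∀ x ∈ [c, c, z, z, z, z], IsTransposition d x := by simp [hc, hz]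
  have twist (e : Bool) := (twistBirth hc e).suffix [y, y, y, y]
  have k₀ (e : Bool) : Tan d [.cross 0 e] [c, c, y, y, y, y] [c, c, y, y, y, y] := by
    cases e <;> exact ⟨by simp, by simp⟩
  have kb : Tan d [.birth 0 c] [y, y, y, y] [c, c, y, y, y, y] := ⟨by simp, by simpa⟩
  have k₁ : Tan d strandFullTwist.toDiagram [c, c, z, z, z, z] [c, c, y, y, y, y] :=
    ⟨by simp [BraidWord.toDiagram, strandFullTwist, *], by
      simp [BraidWord.toDiagram, strandFullTwist]⟩
  have k₂ : Tan d strandFullTwist.inv.toDiagram [c, c, y, y, y, y] [c, c, z, z, z, z] :=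
    tan_inv (n := 6) (by decide) rfl hlev' k₁
  have c₁ := cap_pairFullTwistTwo hc hy
  have k₃ := (c₁.tan_iff.2 kb).split (u := [.birth 0 c]) kb.runs
  have s₁ := (twist false).symm.right k₂
  have s₂ := c₁.symm.right ((k₀ false).append k₂)
  have s₃ := (twist true).symm.right (k₃.2.append ((k₀ false).append k₂))
  have k₄ := (k₀ true).append (k₃.2.append ((k₀ false).append k₂))
  have s₄ := (strandFullTwist_equiv d).tangleEquiv rfl hlev k₄
  have s₅ := s₄.left kb
  exact s₁.trans <| s₂.trans <| s₃.trans s₅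

end TangleEquiv

/-! ### Cutting several pairs of strands -/

theorem IsTransposition.mono {d d' : ℕ} {c : Color} (h : IsTransposition d c) (hd : d ≤ d') :
    IsTransposition d' c := by
  obtain ⟨a, b, h₁, h₂, h₃, rfl⟩ := h
  exact ⟨a, b, h₁, h₂, h₃.trans hd, rfl⟩

/-- The colors of pairs of strands with the given colors. -/
def doubled (l : List Color) : List Color := l.flatMap fun c => [c, c]

theorem doubled_append (l l' : List Color) : doubled (l ++ l') = doubled l ++ doubled l' :=
  List.flatMap_append

@[simp] theorem doubled_cons (c : Color) (l : List Color) :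
    doubled (c :: l) = c :: c :: doubled l := rfl

@[simp] theorem doubled_nil : doubled [] = [] := rfl

theorem length_doubled (l : List Color) : (doubled l).length = 2 * l.length := by
  induction l with
  | nil => rfl
  | cons c l ih => simp [ih]; omega

theorem mem_doubled {l : List Color} {x : Color} : x ∈ doubled l ↔ x ∈ l := by
  simp [doubled]

theorem pairColors_eq (f : ℕ → Color) (m : ℕ) : pairColors f m = doubled ((List.range m).map f) := by
  simp [pairColors, doubled, List.flatMap_map]

theorem tan_births {d : ℕ} {es : List Color} (hes : ∀ x ∈ es, IsTransposition d x)
    (s : List Color) : Tan d (es.map (.birth 0 ·)) s (doubled es.reverse ++ s) := by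
  induction es generalizing s with
  | nil => exact .nil s
  | cons e es ih =>
    have h₁ : Tan d [.birth 0 e] s (e :: e :: s) := ⟨by simp, by simpa using hes e (by simp)⟩
    have := h₁.append (ih (fun x hx => hes x (by simp [hx])) (e :: e :: s))
    simpa [doubled_append] using this

/-- The trivial sheet that joins the labels `d - j` and `d + 1 + j`. -/
def sheet (d j : ℕ) : Diagram := [.birth 0 (swap (d - j) (d + 1 + j)), .death 0]

theorem tan_sheets {d n j : ℕ} (hn : j + n ≤ d - 2) :
    Tan (2 * d - 2) ((List.range' j n).flatMap (sheet d)) [] [] := by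
  induction n generalizing j with
  | zero => exact .nil _
  | succ n ih =>
    refine Tan.append (u := sheet d j) ⟨by simp [sheet], ?_⟩ (ih (by omega))
    simpa [sheet] using ⟨d - j, d + 1 + j, by omega, by omega, by omega, rfl⟩

/-- The sheet shares the label `d - j` with the pair that it cuts, and `d + 1 + j` is its new label.
The bound on `j` is exactly what keeps the latter within `2d - 2`. -/
theorem dihedral_cut {d j : ℕ} (hj : j + 3 ≤ d) : Dihedral (2 * d - 2)
    (swap (d - j) (d + 1 + j)) (swap (d - 1 - j) (d - j)) (swap (d - 1 - j) (d + 1 + j)) where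
  left := isTransposition_swap (by omega) (by omega) (by omega) (by omega) (by omega)
  mid := isTransposition_swap (by omega) (by omega) (by omega) (by omega) (by omega)
  right := isTransposition_swap (by omega) (by omega) (by omega) (by omega) (by omega)
  exists_labels := ⟨d + 1 + j, d - j, d - 1 - j, by omega, by omega, by omega, swap_comm _ _,
    swap_comm _ _, swap_comm _ _⟩

theorem disjointLabels_of_le {p p' k : ℕ} {x : Color} (h : IsTransposition k x) (hp : k < p)
    (hp' : p < p') : DisjointLabels (swap p p') x := by
  obtain ⟨a, b, h₁, h₂, h₃, rfl⟩ := h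
  exact ⟨p, p', a, b, by omega, by omega, by omega, by omega, by omega, by omega, rfl, rfl⟩

/-- The leftmost `n` pairs of strands, colored `(d-1-k  d-k)`, are cut with trivial sheets. -/
theorem cut_pairs {d n j : ℕ} (hn : j + n ≤ d - 2) {f : ℕ → Color}
    (hf : ∀ k, j ≤ k → k < j + n → f k = swap (d - 1 - k) (d - k)) {s : List Color}
    (hs : ∀ x ∈ s, IsTransposition (d - (j + n)) x) {T : Diagram}
    (hT : Tan (2 * d - 2) T [] (doubled ((List.range' j n).map f) ++ s)) :
    ∃ (es : List Color) (g : Color), es.length = n ∧ (∀ e ∈ es, IsTransposition (2 * d - 2) e) ∧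
      (∀ c, IsTransposition (2 * d - 2) c → IsTransposition (2 * d - 2) (g * c * g⁻¹)) ∧
      Tan (2 * d - 2) (T ++ List.replicate n (.death 0)) [] s ∧
      ∀ B R : Diagram, Tan (2 * d - 2) B (doubled ((List.range' j n).map f) ++ s) [] →
        Tan (2 * d - 2) R [] [] →
        TangleEquiv (2 * d - 2) [] [] (T ++ (B ++ ((List.range' j n).flatMap (sheet d) ++ R)))
          (T ++ (List.replicate n (.death 0) ++ (es.map (.birth 0 ·) ++ (recolor g B ++ R)))) ∧
        Tan (2 * d - 2) (recolor g B) (doubled es.reverse ++ s) [] := by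
  induction n generalizing j T with
  | zero =>
    refine ⟨[], 1, rfl, by simp, by simp, by simpa using hT, fun B R hB _ => ?_⟩
    simpa using ⟨TangleEquiv.refl _, hB⟩
  | succ n ih =>
    have hj := dihedral_cut (d := d) (j := j) (by omega)
    set a := swap (d - j) (d + 1 + j)
    set c := swap (d - 1 - j) (d + 1 + j)
    set r := doubled ((List.range' (j + 1) n).map f) ++ s with hr
    have hlev : doubled ((List.range' j (n + 1)).map f) ++ s = f j :: f j :: r := by
      simp [List.range'_succ, hr]
    rw [hlev] at hT ⊢
    have hfj := hf j le_rfl (by omega)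
    rw [← hfj] at hj
    have hr' : ∀ x ∈ r, IsTransposition (d - j - 1) x := by
      intro x hx
      rcases List.mem_append.1 hx with hx | hx
      · obtain ⟨k, hk, rfl⟩ := List.mem_map.1 (mem_doubled.1 hx)
        rw [List.mem_range'_1] at hk
        rw [hf k (by omega) (by omega)]
        exact isTransposition_swap (by omega) (by omega) (by omega) (by omega) (by omega)
      · exact (hs x hx).mono (by omega)
    have hdis : ∀ x ∈ r, DisjointLabels a x := fun x hx =>
      disjointLabels_of_le (hr' x hx) (by omega) (by omega)
    have hd : Tan (2 * d - 2) [.death 0] (f j :: f j :: r) r := ⟨by simp, by simp⟩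
    obtain ⟨es, g, h₁, h₂, h₃, h₄, h₅⟩ := ih (j := j + 1) (by omega)
      (fun k hk hk' => hf k (by omega) (by omega)) (by rwa [add_right_comm, add_assoc])
      (hT.append hd)
    -- The maximum left by the first cut lies below the level of the later cuts, so they conjugate
    -- its color `c` by `g`; the rest of `B` is conjugated first by `a` and then by `g`.
    refine ⟨es ++ [g * c * g⁻¹], g * a, by simp [h₁], ?_, ?_, ?_, fun B R hB hR => ?_⟩
    · intro e he
      rcases List.mem_append.1 he with he | he
      · exact h₂ e he
      · rw [List.mem_singleton.1 he]
        exact h₃ _ hj.right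
    · intro x hx
      simpa [mul_assoc] using h₃ _ (hj.left.conj hx)
    · simpa [List.replicate_succ] using h₄
    · obtain ⟨k₁, k₂⟩ := cut hj hdis (fun x hx => (hr' x hx).mono (by omega)) hT hB
      have hR' := (tan_sheets (d := d) (n := n) (j := j + 1) (by omega)).append hR
      have k₃ : Tan (2 * d - 2) [.birth 0 c] r (c :: c :: r) := ⟨by simp, by simpa using hj.right⟩
      obtain ⟨k₄, k₅⟩ := h₅ _ R (k₃.append k₂) hR
      have k₆ := k₁.right hR'
      refine ⟨.trans ?_ (.trans k₆ (.trans ?_ (.trans k₄ ?_))), ?_⟩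
      · simpa [List.range'_succ, sheet] using TangleEquiv.refl _
      · simpa using TangleEquiv.refl _
      · simpa [List.replicate_succ, recolor_recolor, Piece.recolor] using TangleEquiv.refl _
      · obtain ⟨t, k₇, k₈⟩ := tan_append.1 (recolor_append g [.birth 0 c] _ ▸ k₅)
        have k₉ : Runs (recolor g [.birth 0 c]) (doubled es.reverse ++ s)
            (g * c * g⁻¹ :: g * c * g⁻¹ :: (doubled es.reverse ++ s)) := by
          simp [Piece.recolor]
        cases k₇.runs.det k₉
        simpa [recolor_recolor] using k₈

/-! ### The moves II, III and IV -/

theorem range_eq_append {n m : ℕ} (hn : n ≤ m) :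
    List.range m = List.range' 0 n ++ List.range' n (m - n) := by
  have h := List.range'_append_1 (s := 0) (m := n) (n := m - n)
  rw [Nat.zero_add, Nat.add_sub_cancel' hn] at h
  rw [h, List.range_eq_range']

theorem sheets_eq {d n : ℕ} (hn : n ≤ d - 2) : sheets d =
    (List.range' 0 n).flatMap (sheet d) ++ (List.range' n (d - 2 - n)).flatMap (sheet d) := by
  rw [← List.flatMap_append, ← range_eq_append hn]
  rfl

theorem pairColors_split {f : ℕ → Color} {m n : ℕ} (hn : n ≤ m) : pairColors f m =
    doubled ((List.range' 0 n).map f) ++ doubled ((List.range' n (m - n)).map f) := by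
  rw [pairColors_eq, ← doubled_append, ← List.map_append, ← range_eq_append hn]

theorem InsertsBraid.tangles {d m : ℕ} (hd : 3 ≤ d) {f : ℕ → Color} {β : BraidWord} {L L' : Diagram}
    (h : InsertsBraid d m f β L L') : ∃ T B : Diagram, L = T ++ B ∧ L' = T ++ (β.toDiagram ++ B) ∧
      Tan (2 * d - 2) T [] (pairColors f m) ∧ Tan (2 * d - 2) B (pairColors f m) [] := by
  obtain ⟨top, D, E, htop, rfl, rfl, ⟨hL, gL⟩, hT⟩ := h
  have hL' : Tan (2 * d - 2) ((platTop top ++ D.toDiagram) ++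
      (E.toDiagram ++ List.replicate top.length (.death 0))) [] [] := by
    refine ⟨by simpa [plat, BraidWord.toDiagram_append] using hL, fun i c hc => ?_⟩
    refine (gL i c ?_).mono (by omega)
    simpa [plat, BraidWord.toDiagram_append] using hc
  obtain ⟨h₁, h₂⟩ := hL'.split hT
  exact ⟨_, _, by simp [plat, BraidWord.toDiagram_append], by simp [plat, BraidWord.toDiagram_append],
    h₁, h₂⟩

/-- A braid can be inserted to the right of `i` pairs of strands if, below a maximum in place of the
next pair, it is isotopic to the trivial braid. -/
theorem equiv_of_cap {d m i : ℕ} (hi : i + 3 ≤ d) (hm : i < m) {f : ℕ → Color} {β : BraidWord}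
    (hf : ∀ k, k ≤ i → f k = swap (d - 1 - k) (d - k))
    (hf' : ∀ k, i < k → IsTransposition (d - (i + 1)) (f k))
    (hβ : ∀ e, IsTransposition (2 * d - 2) e →
      let s := doubled ((List.range' (i + 1) (m - (i + 1))).map f)
      Tan (2 * d - 2) β.toDiagram (e :: e :: s) (e :: e :: s) ∧
      TangleEquiv (2 * d - 2) s (e :: e :: s) (.birth 0 e :: β.toDiagram) [.birth 0 e])
    {L L' : Diagram} (h : InsertsBraid d m f (β.shift (2 * i)) L L') :
    TangleEquiv (2 * d - 2) [] [] (L ++ sheets d) (L' ++ sheets d) := by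
  obtain ⟨T, B, rfl, rfl, hT, hB⟩ := h.tangles (by omega)
  rw [pairColors_split (n := i + 1) (by omega)] at hT hB
  set s := doubled ((List.range' (i + 1) (m - (i + 1))).map f) with hs
  have hs' : ∀ x ∈ s, IsTransposition (d - (0 + (i + 1))) x := by
    intro x hx
    obtain ⟨k, hk, rfl⟩ := List.mem_map.1 (mem_doubled.1 hx)
    rw [List.mem_range'_1] at hk
    simpa using hf' k (by omega)
  obtain ⟨es, g, h₁, h₂, -, h₄, h₅⟩ := cut_pairs (n := i + 1) (by omega)
    (fun k _ hk => hf k (by omega)) hs' hT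
  have hR := tan_sheets (d := d) (j := i + 1) (n := d - 2 - (i + 1)) (by omega)
  have hβB : Tan (2 * d - 2) ((β.shift (2 * i)).toDiagram ++ B)
      (doubled ((List.range' 0 (i + 1)).map f) ++ s) [] := by
    refine Tan.append ?_ hB
    have h₃ := ((hβ (f i) ?_).1).shift (doubled ((List.range' 0 i).map f))
    · rw [length_doubled, List.length_map, List.length_range', ← BraidWord.toDiagram_shift] at h₃
      simpa [List.range'_1_concat, doubled_append] using h₃
    · rw [hf i le_rfl]
      exact isTransposition_swap (by omega) (by omega) (by omega) (by omega) (by omega)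
  -- The new maxima `es` and the conjugator `g` do not depend on the part below, so the same cuts
  -- serve with and without the braid.
  obtain ⟨k₁, k₂⟩ := h₅ _ _ hB hR
  obtain ⟨k₃, -⟩ := h₅ _ _ hβB hR
  -- The maximum created first is pushed right by the `i` later ones and becomes pair number `i`, on
  -- which `β` acts. By interchange `β` moves up to it and is absorbed.
  have key : TangleEquiv (2 * d - 2) s (doubled es.reverse ++ s)
      (es.map (.birth 0 ·) ++ (β.shift (2 * i)).toDiagram) (es.map (.birth 0 ·)) := by
    obtain ⟨e, es, rfl⟩ := List.exists_cons_of_length_eq_add_one h₁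
    have he := h₂ e (by simp)
    have h₆ := tan_births (es := es) (fun x hx => h₂ x (by simp [hx])) []
    obtain ⟨c₁, c₂⟩ := hβ e he
    have h₇ := TangleEquiv.interchange h₆ c₁
    have h₈ : (doubled es.reverse ++ []).length = 2 * i := by
      simp [length_doubled] at h₁ ⊢
      omega
    rw [h₈, ← BraidWord.toDiagram_shift, List.length_nil, shift_zero] at h₇
    have h₉ : Tan (2 * d - 2) [.birth 0 e] s (e :: e :: s) := ⟨by simp, by simpa using he⟩
    have e₁ := h₇.left h₉
    have e₂ := c₂.right (h₆.suffix (e :: e :: s))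
    simp only [doubled_append, List.reverse_cons, List.map_cons, List.append_assoc,
      List.nil_append, List.cons_append, doubled_cons, doubled_nil] at e₁ e₂ ⊢
    exact e₁.trans e₂
  have h₆ := (key.right (k₂.append hR)).left h₄
  rw [sheets_eq (n := i + 1) (by omega)]
  rw [recolor_append, recolor_toDiagram] at k₃
  simp only [List.append_assoc] at k₁ k₃ h₆ ⊢
  exact k₁.trans <| h₆.symm.trans <| k₃.symm

/-! ### Move II. -/

theorem standardColor_of_lt {d k : ℕ} (hk : k + 2 ≤ d) :
    standardColor d k = swap (d - 1 - k) (d - k) := if_pos hk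

theorem isTransposition_standardColor {d i k : ℕ} (hi : i + 3 ≤ d) (hk : i < k) :
    IsTransposition (d - (i + 1)) (standardColor d k) := by
  unfold standardColor
  split_ifs
  · exact isTransposition_swap (by omega) (by omega) (by omega) (by omega) (by omega)
  · exact isTransposition_swap (by omega) (by omega) (by omega) (by omega) (by omega)

theorem MoveII.equiv {d i : ℕ} {L L' : Diagram} (h : MoveII d i L L') :
    TangleEquiv (2 * d - 2) [] [] (L ++ sheets d) (L' ++ sheets d) := by
  obtain ⟨hi, m, hm, h⟩ := h
  refine equiv_of_cap (m := m) (β := [(0, true)]) hi (by omega) (fun k hk => standardColor_of_lt (by omega))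
    (fun k hk => isTransposition_standardColor hi hk) (fun e he => ?_)
    (by simpa [BraidWord.shift] using h)
  exact ⟨⟨by simp [BraidWord.toDiagram], by simp [BraidWord.toDiagram]⟩,
    (TangleEquiv.twistBirth he true).suffix _⟩

/-! ### Move III. -/

/-- A pair of parallel strands moves to the left through `r` pairs of strands. -/
def thread : ℕ → BraidWord
  | 0 => []
  | r + 1 => [(2 * r + 1, true), (2 * r + 2, true), (2 * r, false), (2 * r + 1, false)] ++ thread r

theorem pairThread_eq (i r : ℕ) : pairThread i r = (thread r).shift (i + 2) := by
  induction r with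
  | zero => rfl
  | succ r ih =>
    rw [pairThread, thread, BraidWord.shift_append, ih]
    congr 1
    simp [BraidWord.shift]
    omega

/-- Going under a strand colored `b` conjugates both colors of the pair by `b`, so they stay equal.
A strand under the pair is conjugated twice by one transposition and keeps its color. The final
color `z` is irrelevant for absorbing the full twist. -/
theorem tan_thread {d r : ℕ} {P : List Color} {y : Color} (hr : P.length = 2 * r)
    (hP : ∀ x ∈ P, IsTransposition d x) (hy : IsTransposition d y) :
    ∃ z, IsTransposition d z ∧ Tan d (thread r).toDiagram (P ++ [y, y]) (z :: z :: P) := by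
  induction r generalizing P y with
  | zero =>
    rw [List.length_eq_zero_iff.1 hr]
    exact ⟨y, hy, .nil _⟩
  | succ r ih =>
    obtain ⟨P, a, b, rfl⟩ : ∃ Q a b, P = Q ++ [a, b] := by
      obtain ⟨a, b, h⟩ := List.length_eq_two.1 (show (P.drop (2 * r)).length = 2 by simp; omega)
      exact ⟨P.take (2 * r), a, b, by rw [← h, List.take_append_drop]⟩
    have ha := hP a (by simp)
    have hb := hP b (by simp)
    have hr' : P.length = 2 * r := by simpa [mul_add] using hr
    obtain ⟨z, hz, h⟩ := ih hr' (fun x hx => hP x (by simp [hx])) (hb.conj hy)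
    refine ⟨z, hz, ?_⟩
    have h₁ := hy.mul_self
    have h₂ := hb.mul_self
    have k₁ : Tan d [.cross 1 true, .cross 2 true, .cross 0 false, .cross 1 false] [a, b, y, y]
        [b * y * b⁻¹, b * y * b⁻¹, a, b] :=
      ⟨by simp [mul_assoc, inv_of_mul_self, mul_self_mul, h₁, h₂], by simp⟩
    have k₂ := k₁.shift P
    have k₃ := h.suffix [a, b]
    simp only [List.append_assoc, List.cons_append, List.nil_append] at k₂ k₃ ⊢
    have k₄ := k₂.append k₃
    rw [hr'] at k₄
    simpa [thread, BraidWord.toDiagram, Piece.shift, add_comm] using k₄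

theorem thread_lt (r : ℕ) : ∀ x ∈ thread r, x.1 + 1 < 2 * r + 2 := by
  induction r with
  | zero => simp [thread]
  | succ r ih =>
    simp only [thread, List.mem_append, List.mem_cons]
    rintro x ((rfl | rfl | rfl | rfl | h) | h)
    all_goals first
      | exact absurd h (by simp)
      | (have := ih x h; omega)
      | (simp; try omega)

theorem braidIII_eq (i r : ℕ) : braidIII i r = (braidIII 0 r).shift i := by
  have h : (thread r).shift (i + 2) = ((thread r).shift (0 + 2)).shift i := by
    simp [BraidWord.shift, add_comm, add_left_comm]
  simp only [braidIII, pairThread_eq, BraidWord.shift_append, h, BraidWord.inv_shift]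
  congr 2
  simp [BraidWord.shift, pairFullTwist, add_comm]

/-- The maximum slides down past the threading, which does not touch it, absorbs the full twist, and
slides past the returning path; the two paths then cancel. -/
theorem cap_braidIII {d r : ℕ} {P : List Color} {y e : Color} (hr : P.length = 2 * r)
    (hP : ∀ x ∈ P, IsTransposition d x) (hy : IsTransposition d y) (he : IsTransposition d e) :
    Tan d (braidIII 0 r).toDiagram (e :: e :: (P ++ [y, y])) (e :: e :: (P ++ [y, y])) ∧
      TangleEquiv d (P ++ [y, y]) (e :: e :: (P ++ [y, y]))
        (.birth 0 e :: (braidIII 0 r).toDiagram) [.birth 0 e] := by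
  obtain ⟨z, hz, h⟩ := tan_thread hr hP hy
  have hlev : ∀ x ∈ P ++ [y, y], IsTransposition d x := by
    intro x hx
    simp only [List.mem_append, List.mem_cons, List.not_mem_nil, or_false, or_self] at hx
    rcases hx with hx | rfl
    exacts [hP x hx, hy]
  have hlen : (P ++ [y, y]).length = 2 * r + 2 := by simp [hr]
  have h' := tan_inv (thread_lt r) hlen hlev h
  have hb (s : List Color) : Tan d [.birth 0 e] s (e :: e :: s) := ⟨by simp, by simpa using he⟩
  have c := (TangleEquiv.cap_pairFullTwist he hz).suffix P
  have k := ((c.tan_iff.2 (hb (z :: z :: P))).split (u := [.birth 0 e]) (hb _).runs).2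
  have hw : (braidIII 0 r).toDiagram = shift 2 (thread r).toDiagram ++
      ((pairFullTwist 0).toDiagram ++ shift 2 (thread r).inv.toDiagram) := by
    simp [braidIII, pairThread_eq, BraidWord.toDiagram_append, BraidWord.toDiagram_shift,
      BraidWord.inv_shift]
  rw [hw]
  refine ⟨(h.shift [e, e]).append (k.append (h'.shift [e, e])), ?_⟩
  have i₁ := TangleEquiv.interchange (hb []) h
  have i₂ := TangleEquiv.interchange (hb []) h'
  simp only [List.length_nil, shift_zero] at i₁ i₂
  have s₁ := i₁.right (k.append (h'.shift [e, e]))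
  have s₂ := c.ctx h (h'.shift [e, e])
  have s₃ := i₂.left h
  obtain ⟨t, -, -, -, b₁, b₂⟩ := BraidEquiv.cancel_inv (d := d) (thread_lt r) _ hlen hlev
  cases runs_nil.1 b₁.runs
  rw [BraidWord.toDiagram_append] at b₂
  have s₄ := b₂.right (hb _)
  simp only [List.append_assoc] at s₁ s₂ s₃ s₄ ⊢
  exact s₁.trans <| s₂.trans <| s₃.trans s₄

theorem MoveIII.equiv {d i j : ℕ} {L L' : Diagram} (h : MoveIII d i j L L') :
    TangleEquiv (2 * d - 2) [] [] (L ++ sheets d) (L' ++ sheets d) := by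
  obtain ⟨⟨i, rfl⟩, hj, r, rfl, m, hm, h⟩ := h
  have hi : i + 3 ≤ d := by omega
  rw [braidIII_eq, ← two_mul] at h
  refine equiv_of_cap hi (by omega) (fun k hk => standardColor_of_lt (by omega))
    (fun k hk => isTransposition_standardColor hi hk) (fun e he => ?_) h
  -- The pairs right of pair `i` are the `r` intermediate ones, the moving pair, and those that the
  -- braid does not reach.
  have h₁ : List.range' (i + 1) (m - (i + 1)) = List.range' (i + 1) r ++
      (i + 1 + r) :: List.range' (i + 2 + r) (m - (i + 2 + r)) := by
    have h₀ := List.range'_append_1 (s := i + 1) (m := r) (n := m - (i + 2 + r) + 1)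
    rw [show r + (m - (i + 2 + r) + 1) = m - (i + 1) by omega, List.range'_succ,
      show i + 1 + r + 1 = i + 2 + r by omega] at h₀
    exact h₀.symm
  have ht (k : ℕ) (hk : i < k) : IsTransposition (2 * d - 2) (standardColor d k) :=
    (isTransposition_standardColor hi hk).mono (by omega)
  have h₂ := cap_braidIII (r := r) (P := doubled ((List.range' (i + 1) r).map (standardColor d)))
    (by simp [length_doubled]) (by
      intro x hx
      obtain ⟨k, hk, rfl⟩ := List.mem_map.1 (mem_doubled.1 hx)
      rw [List.mem_range'_1] at hk
      exact ht k (by omega)) (ht (i + 1 + r) (by omega)) he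
  have h₃ := h₂.1.suffix (doubled ((List.range' (i + 2 + r) (m - (i + 2 + r))).map (standardColor d)))
  have h₄ := h₂.2.suffix (doubled ((List.range' (i + 2 + r) (m - (i + 2 + r))).map (standardColor d)))
  simp only [h₁, List.map_append, List.map_cons, doubled_append, doubled_cons]
  simp only [List.append_assoc, List.cons_append, List.nil_append] at h₃ h₄
  exact ⟨h₃, h₄⟩

/-! ### Move IV. -/

theorem colorIV_of_lt {d k : ℕ} (hk : k + 4 ≤ d) : colorIV d k = swap (d - 1 - k) (d - k) :=
  if_pos hk

theorem dihedral_two_three {d : ℕ} (hd : 3 ≤ d) :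
    Dihedral d (swap 2 3) (swap 1 3) (swap 1 2) where
  left := isTransposition_swap (by omega) (by omega) (by omega) hd (by omega)
  mid := isTransposition_swap (by omega) (by omega) (by omega) hd (by omega)
  right := isTransposition_swap (by omega) (by omega) (by omega) (by omega) (by omega)
  exists_labels := ⟨2, 3, 1, by omega, by omega, by omega, rfl, swap_comm _ _, swap_comm _ _⟩

/-- Move IV in the presence of an unknot colored `(3 n)`, for a level without strands to the left of
the inserted braid. -/
theorem equiv_braidIV {d n : ℕ} (hn : 3 < n) (hnd : n ≤ d) {s : List Color}
    (hs : ∀ x ∈ s, IsTransposition 2 x) {T B : Diagram}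
    (hT : Tan d T [] (doubled [swap 2 3, swap 1 3, swap 2 3] ++ s))
    (hB : Tan d B (doubled [swap 2 3, swap 1 3, swap 2 3] ++ s) []) :
    Tan d (braidIV 3).toDiagram (doubled [swap 2 3, swap 1 3, swap 2 3] ++ s)
      (doubled [swap 2 3, swap 1 3, swap 2 3] ++ s) ∧
    TangleEquiv d [] [] (T ++ (B ++ [.birth 0 (swap 3 n), .death 0]))
      (T ++ ((braidIV 3).toDiagram ++ (B ++ [.birth 0 (swap 3 n), .death 0]))) := by
  have h := dihedral_two_three (d := d) (by omega)
  have hq := h.left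
  have hp := h.mid
  have hy := h.right
  have h' : Dihedral d (swap 3 n) (swap 1 3) (swap 1 n) :=
    ⟨isTransposition_swap (by omega) (by omega) (by omega) (by omega) (by omega), hp,
      isTransposition_swap (by omega) (by omega) (by omega) (by omega) (by omega),
      n, 3, 1, by omega, by omega, by omega, swap_comm _ _, swap_comm _ _, swap_comm _ _⟩
  have h'' : Dihedral d (swap 1 n) (swap 1 2) (swap 2 n) :=
    ⟨h'.right, hy, isTransposition_swap (by omega) (by omega) (by omega) (by omega) (by omega),
      n, 1, 2, by omega, by omega, by omega, swap_comm _ _, rfl, swap_comm _ _⟩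
  have hlev₀ : ∀ x ∈ swap 1 2 :: swap 1 2 :: swap 1 2 :: swap 1 2 :: s, IsTransposition 2 x := by
    have h₀ : IsTransposition 2 (swap 1 2) :=
      isTransposition_swap le_rfl (by omega) (by omega) le_rfl (by omega)
    simpa [h₀] using hs
  have hdis : ∀ x ∈ swap 1 2 :: swap 1 2 :: swap 1 2 :: swap 1 2 :: s,
      DisjointLabels (swap 3 n) x := fun x hx =>
    disjointLabels_of_le (hlev₀ x hx) (by omega) hn
  generalize swap 2 3 = q at *
  generalize swap 1 3 = p at *
  generalize swap 1 2 = y at *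
  generalize swap 3 n = a at *
  generalize swap 1 n = c at *
  generalize swap 2 n = z at *
  have h₁ := h.conj
  have h₂ := h.rotate.rotate.conj
  have h₃ := h.rotate.conj
  have h₄ := h.flip.conj
  have h₅ := h.rotate.flip.conj
  have h₆ := h.rotate.rotate.flip.conj
  have l₁ : ∀ x ∈ [q, q, p, p, q, q], IsTransposition d x := by simp [hp, hq]
  have l₂ : ∀ x ∈ [p, p, q, q, q, q], IsTransposition d x := by simp [hp, hq]
  have t₁ : Tan d pairCross.toDiagram [q, q, p, p, q, q] [p, p, q, q, q, q] :=
    ⟨by simp [BraidWord.toDiagram, pairCross, *], by simp [BraidWord.toDiagram, pairCross]⟩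
  have t₂ : Tan d strandFullTwist.toDiagram [p, p, q, q, q, q] [p, p, y, y, y, y] :=
    ⟨by simp [BraidWord.toDiagram, strandFullTwist, *], by
      simp [BraidWord.toDiagram, strandFullTwist]⟩
  have t₃ : Tan d (BraidWord.toDiagram ((0, true) :: (strandFullTwist ++ [(0, true)])))
      [p, p, y, y, y, y] [p, p, q, q, q, q] :=
    ⟨by simp [BraidWord.toDiagram, strandFullTwist, *], by
      simp [BraidWord.toDiagram, strandFullTwist]⟩
  have t₁' := tan_inv (n := 6) (by decide) rfl l₁ t₁
  have t₂' := tan_inv (n := 6) (by decide) rfl l₂ t₂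
  have e₁ : TangleEquiv d _ _ _ _ := (braidIV_equiv d).symm.tangleEquiv (t := [q, q, p, p, q, q])
    rfl l₁ (by
      have := (t₁.append t₂).append (t₃.append t₁')
      simpa [BraidWord.toDiagram] using this)
  -- The trivial braid is written with the same upper part as the factored braid, so that both
  -- diagrams are cut at the same level below it.
  have e₂ : BraidEquiv d 6 (pairCross ++ strandFullTwist ++
      (strandFullTwist.inv ++ pairCross.inv)) [] := .of_rewriteAll
    (l := [11, 10, 9, 8, 7, 6, 5, 4, 3, 2, 1, 0].map (·, none)) (by decide) rfl
  have e₂' := e₂.tangleEquiv (t := [q, q, p, p, q, q]) rfl l₁ (by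
    have := (t₁.append t₂).append (t₂'.append t₁')
    simpa [BraidWord.toDiagram] using this)
  have tβ := (e₁.tan_iff.1 (by
    have := (t₁.append t₂).append (t₃.append t₁')
    simpa [BraidWord.toDiagram] using this)).suffix s
  refine ⟨tβ, ?_⟩
  have hu : Tan d [.birth 0 a, .death 0] [] [] := ⟨by simp, by simpa using h'.left⟩
  have hT' := hT.append ((t₁.append t₂).suffix s)
  have hB' := (t₁'.suffix s).append hB
  have hlev : ∀ x ∈ y :: y :: y :: y :: s, IsTransposition d x := fun x hx =>
    (hlev₀ x hx).mono (by omega)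
  -- At this level the four encircled strands have turned from `(2 3)` to `(1 2)`. All strands other
  -- than the pair `(1 3)` now avoid the labels of the sheet `(3 n)`, as the cut requires.
  obtain ⟨c₁, b₁⟩ := cut h' hdis hlev hT' ((t₂'.suffix s).append hB')
  obtain ⟨c₂, b₂⟩ := cut h' hdis hlev hT' ((t₃.suffix s).append hB')
  have hd : Tan d [.death 0] (p :: p :: y :: y :: y :: y :: s) (y :: y :: y :: y :: s) :=
    ⟨by simp, by simp⟩
  -- Below the new maximum, colored `(1 n)`, the two ways to continue, `F⁻¹` and `x₀ F x₀`, are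
  -- equivalent.
  have e₃ := (TangleEquiv.cap_strandFullTwist h'').suffix s
  have t₄ : Tan d strandFullTwist.toDiagram [c, c, z, z, z, z] [c, c, y, y, y, y] :=
    ⟨by simp [BraidWord.toDiagram, strandFullTwist, h''.rotate.conj, h''.flip.conj,
      h''.flip.rotate.conj], by
      simp [BraidWord.toDiagram, strandFullTwist]⟩
  have t₄' := tan_inv (n := 6) (by decide) rfl (by simp [h''.left, h''.right]) t₄
  rw [recolor_append, recolor_toDiagram] at b₁ c₁ c₂
  have e₄ := ((e₃.right (b₁.split (t₄'.suffix s).runs).2).left hd).left hT'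
  have f₁ := ((e₂'.suffix s).right (hB.append hu)).left hT
  have f₂ := ((e₁.suffix s).right (hB.append hu)).left hT
  have h₀ : BraidWord.toDiagram [] = [] := rfl
  simp only [BraidWord.toDiagram_append, List.append_assoc, List.cons_append, List.nil_append,
    h₀] at c₁ c₂ e₄ f₁ f₂ ⊢
  exact f₁.symm.trans <| c₁.trans <| e₄.trans <| c₂.symm.trans f₂

theorem braidIV_eq {d : ℕ} (hd : 3 ≤ d) : braidIV d = (braidIV 3).shift (2 * (d - 3)) := by
  obtain ⟨k, rfl⟩ := Nat.exists_eq_add_of_le hd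
  simp [braidIV, pairFullTwist, BraidWord.shift]
  omega

theorem MoveIV.equiv {d : ℕ} (hd : 3 ≤ d) {L L' : Diagram} (h : MoveIV d L L') :
    TangleEquiv (2 * d - 2) [] [] (L ++ sheets d) (L' ++ sheets d) := by
  obtain ⟨m, hm, h⟩ := h
  rw [braidIV_eq hd] at h
  obtain ⟨T, B, rfl, rfl, hT, hB⟩ := h.tangles hd
  rw [pairColors_split (n := d - 3) (by omega)] at hT hB
  set s := doubled ((List.range' (d - 3) (m - (d - 3))).map (colorIV d)) with hs
  have hs₀ : s = doubled [swap 2 3, swap 1 3, swap 2 3] ++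
      doubled ((List.range' d (m - d)).map (colorIV d)) := by
    have h₀ : m - (d - 3) = m - d + 1 + 1 + 1 := by omega
    have h₁ : colorIV d (d - 3) = swap 2 3 := by
      rw [colorIV, if_neg (by omega), if_pos (by omega)]
    have h₂ : colorIV d (d - 3 + 1) = swap 1 3 := by
      rw [colorIV, if_neg (by omega), if_neg (by omega), if_pos (by omega)]
    have h₃ : colorIV d (d - 3 + 1 + 1) = swap 2 3 := by
      rw [colorIV, if_neg (by omega), if_neg (by omega), if_neg (by omega), if_pos (by omega)]
    have h₄ : d - 3 + 1 + 1 + 1 = d := by omega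
    rw [hs, h₀, List.range'_succ, List.range'_succ, List.range'_succ, h₄]
    simp [h₁, h₂, h₃]
  set r := doubled ((List.range' d (m - d)).map (colorIV d))
  have hr : ∀ x ∈ r, IsTransposition 2 x := by
    intro x hx
    obtain ⟨k, hk, rfl⟩ := List.mem_map.1 (mem_doubled.1 hx)
    rw [List.mem_range'_1] at hk
    rw [colorIV, if_neg (by omega), if_neg (by omega), if_neg (by omega), if_neg (by omega)]
    exact isTransposition_swap le_rfl (by omega) (by omega) le_rfl (by omega)
  have hs' : ∀ x ∈ s, IsTransposition (d - (0 + (d - 3))) x := by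
    intro x hx
    have h₁ : d - (0 + (d - 3)) = 3 := by omega
    rw [h₁]
    rw [hs₀, List.mem_append] at hx
    rcases hx with hx | hx
    · have h₂ := dihedral_two_three le_rfl
      have hx := mem_doubled.1 hx
      simp only [List.mem_cons, List.not_mem_nil, or_false] at hx
      rcases hx with rfl | rfl | rfl
      exacts [h₂.left, h₂.mid, h₂.left]
    · exact (hr x hx).mono (by omega)
  -- The pairs `(d-1 d), …, (3 4)` use up all sheets but the last, which is colored `(3 2d-2)` and
  -- is left for the braid itself.
  obtain ⟨es, g, h₁, h₂, -, h₄, h₅⟩ := cut_pairs (n := d - 3) (by omega)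
    (fun k _ hk => colorIV_of_lt (by omega)) hs' hT
  have hu : Tan (2 * d - 2) [.birth 0 (swap 3 (2 * d - 2)), .death 0] [] [] :=
    ⟨by simp, by simpa using
      isTransposition_swap (by omega) (by omega) (by omega) le_rfl (by omega)⟩
  have hsheets : sheets d = (List.range' 0 (d - 3)).flatMap (sheet d) ++
      [.birth 0 (swap 3 (2 * d - 2)), .death 0] := by
    rw [sheets_eq (n := d - 3) (by omega), show d - 2 - (d - 3) = 1 by omega]
    simp only [List.range'_one, List.flatMap_cons, List.flatMap_nil, List.append_nil, sheet]
    rw [show d - (d - 3) = 3 by omega, show d + 1 + (d - 3) = 2 * d - 2 by omega]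
  have hb := tan_births h₂ s
  have hB₁ := hb.append (h₅ B _ hB hu).2
  rw [hs₀] at h₄ hB₁
  obtain ⟨k₁, k₂⟩ := equiv_braidIV (by omega) le_rfl hr h₄ hB₁
  have k₃ : Tan (2 * d - 2) (braidIV 3).toDiagram s s := by
    rw [hs₀]
    exact k₁
  have i₀ := k₃.shift (doubled ((List.range' 0 (d - 3)).map (colorIV d)))
  rw [length_doubled, List.length_map, List.length_range', ← BraidWord.toDiagram_shift] at i₀
  obtain ⟨c₁, c₂⟩ := h₅ B _ hB hu
  obtain ⟨c₃, -⟩ := h₅ _ _ (i₀.append hB) hu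
  -- `equiv_braidIV` puts the braid above the new maxima, at the far left. Moved below them it lies
  -- right of `d - 3` pairs, as in the recolored `L'`.
  have i₁ := TangleEquiv.interchange (tan_births h₂ []) k₃
  have hlen : (doubled es.reverse ++ []).length = 2 * (d - 3) := by
    simp [length_doubled, h₁]
  rw [hlen, ← BraidWord.toDiagram_shift, List.length_nil, shift_zero, List.append_nil] at i₁
  rw [← hs₀] at h₄
  have i₂ := (i₁.right (c₂.append hu)).left h₄
  rw [hsheets]
  rw [recolor_append, recolor_toDiagram] at c₃
  simp only [List.append_assoc] at c₁ c₃ i₂ k₂ ⊢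
  exact c₁.trans <| k₂.trans <| i₂.symm.trans c₃.symm

theorem theorem2 (d : ℕ) (hd : 3 ≤ d) :
    (∀ (i : ℕ) (L L' : Diagram), MoveII d i L L' →
      CNEquivalent (2 * d - 2) (L ++ sheets d) (L' ++ sheets d)) ∧
    (∀ (i j : ℕ) (L L' : Diagram), MoveIII d i j L L' →
      CNEquivalent (2 * d - 2) (L ++ sheets d) (L' ++ sheets d)) ∧
    (∀ L L' : Diagram, MoveIV d L L' →
      CNEquivalent (2 * d - 2) (L ++ sheets d) (L' ++ sheets d)) :=
  ⟨fun _ _ _ h => h.equiv.cnEquivalent, fun _ _ _ _ h => h.equiv.cnEquivalent,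
    fun _ _ h => (h.equiv hd).cnEquivalent⟩
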